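/- Let $G$ be a locally compact (Hausdorff) unimodular group with bi-invariant Haar measure $\mathrm{d}g$, and let $X$ be a complete Riemannian manifold on which $G$ acts properly, cocompactly and isometrically (each $g\in G$ acting by a smooth isometry), with Riemannian measure $\mathrm{d}x$. Let $E\to X$ be a smooth finite-dimensional complex $G$-vector bundle with a $G$-invariant Hermitian structure, and let $L^2(X,E)$ be the completion of $C_c(X,E)$ for $\langle f,h\rangle=\int_X\langle f(x),h(x)\rangle_{E_x}\,\mathrm{d}x$, with the $G$-action $(g\cdot f)(x)=g(f(g^{-1}x))$. A function $c\in C_c^\infty(X)$ acts on $L^2(X,E)$ by multiplication; it is a cutoff function if $c\ge 0$ and $\int_G c(g^{-1}x)\,\mathrm{d}g=1$ for all $x\in X$. A bounded operator $T$ on a Hilbert space is of trace class if $\sum_i\langle |T|e_i,e_i\rangle<\infty$ for an orthonormal basis $(e_i)$, and then $\mathrm{tr}(T)=\sum_i\langle Te_i,e_i\rangle$. A bounded operator $S$ on $L^2(X,E)$ that commutes with the action of $G$ is of $G$-trace class if $\phi|S|\psi$ is of trace class for all $\phi,\psi\in C_c^\infty(X)$. Let $S$ be a positive operator of $G$-trace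 class on $L^2(X,E)$, and let $c_1,c_2,d_1,d_2\in C_c^\infty(X)$ be nonnegative functions such that $c_1c_2$ and $d_1d_2$ are cutoff functions, that is, $$\int_G c_1(g^{-1}x)c_2(g^{-1}x)\,\mathrm{d}g=1\quad\text{and}\quad \int_G d_1(g^{-1}x)d_2(g^{-1}x)\,\mathrm{d}g=1\qquad\text{for all }x\in X.$$ Then $c_1Sc_2$ and $d_1Sd_2$ are of trace class and $$\mathrm{tr}(c_1Sc_2)=\mathrm{tr}(d_1Sd_2).$$ Hence the $G$-trace $\mathrm{tr}_G(S)=\mathrm{tr}(c_1Sc_2)$ does not depend on the choice of such $c_1,c_2$, i.e. it is well defined. -/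

import Mathlib

open MeasureTheory Bundle Manifold
open scoped ContDiff

noncomputable section

namespace GTrace

open Set Filter Topology

section GramDet
variable {n : ℕ} {V : Type*} [NormedAddCommGroup V] [InnerProductSpace ℝ V]

/-- `√(det ⟪L bᵢ, L bⱼ⟫)` for a linear map `L : ℝⁿ → V`, where `b` is the standard basis of `ℝⁿ`:
the factor by which `L` scales `n`-dimensional volume. -/
def volumeFactor (L : EuclideanSpace ℝ (Fin n) →ₗ[ℝ] V) : ℝ :=
  √(Matrix.of fun i j => inner ℝ (L (EuclideanSpace.basisFun (Fin n) ℝ i))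
    (L (EuclideanSpace.basisFun (Fin n) ℝ j))).det

theorem volumeFactor_comp (L : EuclideanSpace ℝ (Fin n) →ₗ[ℝ] V)
    (T : EuclideanSpace ℝ (Fin n) →ₗ[ℝ] EuclideanSpace ℝ (Fin n)) :
    volumeFactor (L ∘ₗ T) = |LinearMap.det T| * volumeFactor L := by
  let b := EuclideanSpace.basisFun (Fin n) ℝ
  let A := LinearMap.toMatrix b.toBasis b.toBasis T
  have hT : ∀ i, T (b i) = ∑ k, A k i • b k := by
    intro i
    have := (b.toBasis.sum_repr (T (b i))).symm
    simpa [A, LinearMap.toMatrix_apply] using this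
  have hmat : (Matrix.of fun i j => inner ℝ ((L ∘ₗ T) (b i)) ((L ∘ₗ T) (b j))) =
      A.transpose * (Matrix.of fun i j => inner ℝ (L (b i)) (L (b j))) * A := by
    ext i j
    simp only [Matrix.of_apply, LinearMap.comp_apply, hT, map_sum, map_smul, Matrix.mul_apply,
      Matrix.transpose_apply, sum_inner, inner_sum, real_inner_smul_left, real_inner_smul_right,
      Finset.sum_mul]
    refine Finset.sum_congr rfl fun k _ => Finset.sum_congr rfl fun l _ => by ring
  unfold volumeFactor
  rw [show (Matrix.of fun i j => inner ℝ ((L ∘ₗ T) (EuclideanSpace.basisFun (Fin n) ℝ i))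
    ((L ∘ₗ T) (EuclideanSpace.basisFun (Fin n) ℝ j))) = _ from hmat, Matrix.det_mul, Matrix.det_mul,
    Matrix.det_transpose, LinearMap.det_toMatrix, mul_right_comm, ← pow_two,
    Real.sqrt_mul (sq_nonneg _), Real.sqrt_sq_eq_abs]

end GramDet

theorem isContinuousRiemannianBundle_of_contMDiff {n : ℕ} {X : Type*} [TopologicalSpace X]
    [ChartedSpace (EuclideanSpace ℝ (Fin n)) X] (F : Type*) [NormedAddCommGroup F]
    [NormedSpace ℝ F] (E : X → Type*) [TopologicalSpace (TotalSpace F E)]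
    [∀ x, NormedAddCommGroup (E x)] [∀ x, InnerProductSpace ℝ (E x)] [FiberBundle F E]
    [VectorBundle ℝ F E] [h : IsContMDiffRiemannianBundle (𝓡 n) ∞ F E] :
    IsContinuousRiemannianBundle F E := by
  obtain ⟨g, hg, hi⟩ := h.exists_contMDiff
  exact ⟨g, hg.continuous, hi⟩

section Volume

set_option linter.unusedSectionVars false

variable {n : ℕ} {X : Type*} [TopologicalSpace X] [ChartedSpace (EuclideanSpace ℝ (Fin n)) X]
  [IsManifold (𝓡 n) ∞ X] [RiemannianBundle (fun x : X => TangentSpace (𝓡 n) x)]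

/-- The Riemannian density `√(det gᵢⱼ)` in the chart `e`, as a function on the target of `e`. -/
def chartDensity (e : OpenPartialHomeomorph X (EuclideanSpace ℝ (Fin n)))
    (y : EuclideanSpace ℝ (Fin n)) : ℝ :=
  volumeFactor (V := TangentSpace (𝓡 n) (e.symm y)) (mfderiv (𝓡 n) (𝓡 n) e.symm y).toLinearMap

variable [MeasurableSpace X]

/-- The measure `√(det gᵢⱼ) dy` of the chart `e`, carried over to the domain of `e`. -/
def chartMeasure (e : OpenPartialHomeomorph X (EuclideanSpace ℝ (Fin n))) : Measure X :=
  (((volume : Measure (EuclideanSpace ℝ (Fin n))).restrict e.target).withDensity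
    fun y => ENNReal.ofReal (chartDensity e y)).map e.symm

variable (n X) in
/-- The Riemannian measure of `X`: the measure that is `√(det gᵢⱼ) dy` in every smooth chart. -/
def riemannianVolume : Measure X :=
  ⨆ e ∈ IsManifold.maximalAtlas (𝓡 n) ∞ X, chartMeasure e


theorem volumeFactor_congr {x x' : X} (hx : x = x')
    (L : EuclideanSpace ℝ (Fin n) →ₗ[ℝ] TangentSpace (𝓡 n) x)
    (L' : EuclideanSpace ℝ (Fin n) →ₗ[ℝ] TangentSpace (𝓡 n) x')
    (h : ∀ v, (L v : EuclideanSpace ℝ (Fin n)) = L' v) :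
    volumeFactor L = volumeFactor L' := by
  subst hx
  congr 1
  exact LinearMap.ext h

theorem chartDensity_eq {e e' : OpenPartialHomeomorph X (EuclideanSpace ℝ (Fin n))}
    (he : e ∈ IsManifold.maximalAtlas (𝓡 n) ∞ X) (he' : e' ∈ IsManifold.maximalAtlas (𝓡 n) ∞ X)
    {y : EuclideanSpace ℝ (Fin n)} (hy : y ∈ e.target) (hy' : e.symm y ∈ e'.source) :
    DifferentiableAt ℝ (e' ∘ e.symm) y ∧
    chartDensity e y = |(fderiv ℝ (e' ∘ e.symm) y).det| * chartDensity e' (e' (e.symm y)) := by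
  have h1 : MDifferentiableAt (𝓡 n) (𝓡 n) e.symm y :=
    ((contMDiffOn_symm_of_mem_maximalAtlas he).contMDiffAt
      (e.open_target.mem_nhds hy)).mdifferentiableAt (by simp)
  have h2 : MDifferentiableAt (𝓡 n) (𝓡 n) e' (e.symm y) :=
    ((contMDiffOn_of_mem_maximalAtlas he').contMDiffAt
      (e'.open_source.mem_nhds hy')).mdifferentiableAt (by simp)
  have h3 : MDifferentiableAt (𝓡 n) (𝓡 n) (e' ∘ e.symm) y := h2.comp y h1
  have h4 : MDifferentiableAt (𝓡 n) (𝓡 n) e'.symm (e' (e.symm y)) :=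
    ((contMDiffOn_symm_of_mem_maximalAtlas he').contMDiffAt
      (e'.open_target.mem_nhds (e'.map_source hy'))).mdifferentiableAt (by simp)
  refine ⟨h3.differentiableAt, ?_⟩
  have hev : e'.symm ∘ (e' ∘ e.symm) =ᶠ[𝓝 y] e.symm := by
    have := (e.continuousAt_symm hy).preimage_mem_nhds (e'.open_source.mem_nhds hy')
    filter_upwards [this] with z hz
    simp [e'.left_inv hz]
  have hd : mfderiv (𝓡 n) (𝓡 n) e.symm y =
      (mfderiv (𝓡 n) (𝓡 n) e'.symm (e' (e.symm y))).comp
        (mfderiv (𝓡 n) (𝓡 n) (e' ∘ e.symm) y) := by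
    rw [← hev.mfderiv_eq]
    exact mfderiv_comp y h4 h3
  have hd' := mfderiv_eq_fderiv (𝕜 := ℝ) (f := e' ∘ e.symm) (x := y)
  unfold chartDensity
  refine Eq.trans ?_ (volumeFactor_comp (V := TangentSpace (𝓡 n) (e'.symm (e' (e.symm y))))
    (mfderiv (𝓡 n) (𝓡 n) e'.symm (e' (e.symm y))).toLinearMap
    (fderiv ℝ (e' ∘ e.symm) y).toLinearMap)
  refine volumeFactor_congr (by rw [e'.left_inv hy']) _ _ fun v => ?_
  have := congrArg (fun L => (L v : EuclideanSpace ℝ (Fin n))) hd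
  refine this.trans ?_
  change (mfderiv (𝓡 n) (𝓡 n) e'.symm (e' (e.symm y))) (mfderiv (𝓡 n) (𝓡 n) (e' ∘ e.symm) y v) = _
  rw [hd']
  rfl

variable [BorelSpace X]

theorem chartMeasure_apply (e : OpenPartialHomeomorph X (EuclideanSpace ℝ (Fin n)))
    {A : Set X} (hA : MeasurableSet A) :
    MeasurableSet (e.target ∩ e.symm ⁻¹' A) ∧
    chartMeasure e A =
      ∫⁻ y in e.target ∩ e.symm ⁻¹' A, ENNReal.ofReal (chartDensity e y) := by
  have hm : MeasurableSet (e.target ∩ e.symm ⁻¹' A) := by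
    classical
    have := e.continuousOn_symm.measurable_piecewise (g := fun _ => e.symm 0)
      continuous_const.continuousOn e.open_target.measurableSet
    have h2 := (this hA).inter e.open_target.measurableSet
    convert h2 using 1
    ext z
    by_cases hz : z ∈ e.target <;> simp [hz]
  refine ⟨hm, ?_⟩
  have haem : AEMeasurable e.symm ((volume : Measure (EuclideanSpace ℝ (Fin n))).restrict e.target) :=
    e.continuousOn_symm.aemeasurable e.open_target.measurableSet
  have hae := haem.mono_ac (withDensity_absolutelyContinuous _
    (fun y => ENNReal.ofReal (chartDensity e y)))
  rw [chartMeasure, Measure.map_apply_of_aemeasurable hae hA]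
  rw [withDensity_apply', Measure.restrict_restrict' e.open_target.measurableSet, inter_comm]

theorem chartMeasure_eq {e e' : OpenPartialHomeomorph X (EuclideanSpace ℝ (Fin n))}
    (he : e ∈ IsManifold.maximalAtlas (𝓡 n) ∞ X) (he' : e' ∈ IsManifold.maximalAtlas (𝓡 n) ∞ X)
    {A : Set X} (hA : MeasurableSet A) (h : A ⊆ e.source) (h' : A ⊆ e'.source) :
    chartMeasure e A = chartMeasure e' A := by
  obtain ⟨hm, h1⟩ := chartMeasure_apply e hA
  obtain ⟨hm', h2⟩ := chartMeasure_apply e' hA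
  have himg : e'.target ∩ e'.symm ⁻¹' A = (e' ∘ e.symm) '' (e.target ∩ e.symm ⁻¹' A) := by
    ext z
    constructor
    · rintro ⟨hz, hzA⟩
      refine ⟨e (e'.symm z), ⟨e.map_source (h hzA), ?_⟩, ?_⟩
      · simpa [e.left_inv (h hzA)] using hzA
      · simp [e.left_inv (h hzA), e'.right_inv hz]
    · rintro ⟨y, ⟨hy, hyA⟩, rfl⟩
      refine ⟨e'.map_source (h' hyA), ?_⟩
      simpa [e'.left_inv (h' hyA)] using hyA
  rw [h1, h2, himg, lintegral_image_eq_lintegral_abs_det_fderiv_mul volume hm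
    (f' := fderiv ℝ (e' ∘ e.symm))]
  · refine setLIntegral_congr_fun hm fun y hy => ?_
    rw [(chartDensity_eq he he' hy.1 (h' hy.2)).2, ENNReal.ofReal_mul (abs_nonneg _)]
    rfl
  · intro y hy
    exact (chartDensity_eq he he' hy.1 (h' hy.2)).1.hasFDerivAt.hasFDerivWithinAt
  · intro y hy z hz hyz
    have : e.symm y = e.symm z := e'.injOn (h' hy.2) (h' hz.2) hyz
    exact e.symm.injOn hy.1 hz.1 this

theorem chartMeasure_compl_source (e : OpenPartialHomeomorph X (EuclideanSpace ℝ (Fin n))) :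
    chartMeasure e e.sourceᶜ = 0 := by
  rw [(chartMeasure_apply e e.open_source.measurableSet.compl).2]
  have : e.target ∩ e.symm ⁻¹' e.sourceᶜ = ∅ := by
    ext y
    simp only [mem_inter_iff, mem_preimage, mem_compl_iff, mem_empty_iff_false, iff_false, not_and,
      not_not]
    exact fun hy => e.map_target hy
  rw [this, Measure.restrict_empty, lintegral_zero_measure]

/-- In every smooth chart the Riemannian measure is `√(det gᵢⱼ) dy`. -/
theorem riemannianVolume_restrict_source
    {e : OpenPartialHomeomorph X (EuclideanSpace ℝ (Fin n))}
    (he : e ∈ IsManifold.maximalAtlas (𝓡 n) ∞ X) :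
    (riemannianVolume n X).restrict e.source = chartMeasure e := by
  have hs := e.open_source.measurableSet
  have hle : ∀ e' ∈ IsManifold.maximalAtlas (𝓡 n) ∞ X, chartMeasure e' ≤ riemannianVolume n X :=
    fun e' he' => le_iSup₂_of_le e' he' le_rfl
  have hsup : riemannianVolume n X ≤
      chartMeasure e + (riemannianVolume n X).restrict e.sourceᶜ := by
    refine iSup₂_le fun e' he' => Measure.le_iff.2 fun A hA => ?_
    have h0 : chartMeasure e' (A ∩ e.source) ≤ chartMeasure e A := by
      have hA' := hA.inter hs
      have hz : chartMeasure e' ((A ∩ e.source) \ e'.source) = 0 :=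
        measure_mono_null (fun x hx => hx.2) (chartMeasure_compl_source e')
      rw [← measure_inter_add_sdiff (A ∩ e.source) e'.open_source.measurableSet, hz, add_zero,
        chartMeasure_eq he' he (hA'.inter e'.open_source.measurableSet) inter_subset_right
          (inter_subset_left.trans inter_subset_right)]
      exact measure_mono (inter_subset_left.trans inter_subset_left)
    rw [← measure_inter_add_sdiff A hs, Measure.add_apply, Measure.restrict_apply hA]
    exact add_le_add h0 (hle e' he' _)
  refine le_antisymm ?_ ?_
  · refine Measure.le_iff.2 fun A hA => ?_
    rw [Measure.restrict_apply hA]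
    refine (hsup _).trans ?_
    rw [Measure.add_apply, Measure.restrict_apply (hA.inter hs)]
    have : A ∩ e.source ∩ e.sourceᶜ = ∅ := by
      rw [inter_assoc, inter_compl_self, inter_empty]
    rw [this, measure_empty, add_zero]
    exact measure_mono inter_subset_left
  · refine Measure.le_iff.2 fun A hA => ?_
    rw [Measure.restrict_apply hA, ← measure_inter_add_sdiff A hs,
      measure_mono_null (s := A \ e.source) (fun x hx => hx.2) (chartMeasure_compl_source e),
      add_zero]
    exact hle e he _

section LocallyFinite

variable [IsContMDiffRiemannianBundle (𝓡 n) ∞ (EuclideanSpace ℝ (Fin n))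
  (fun x : X => TangentSpace (𝓡 n) x)]

theorem continuousOn_chartDensity {e : OpenPartialHomeomorph X (EuclideanSpace ℝ (Fin n))}
    (he : e ∈ IsManifold.maximalAtlas (𝓡 n) ∞ X) : ContinuousOn (chartDensity e) e.target := by
  have hsec : ∀ v : EuclideanSpace ℝ (Fin n), ContinuousOn
      (fun y => (⟨e.symm y, mfderiv (𝓡 n) (𝓡 n) e.symm y v⟩ : TangentBundle (𝓡 n) X))
      e.target := by
    intro v
    have h1 := (contMDiffOn_symm_of_mem_maximalAtlas he).continuousOn_tangentMapWithin
      (by simp) e.open_target.uniqueMDiffOn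
    have h2 : Continuous (fun y : EuclideanSpace ℝ (Fin n) =>
        (⟨y, v⟩ : TangentBundle (𝓡 n) (EuclideanSpace ℝ (Fin n)))) :=
      (tangentBundleModelSpaceHomeomorph (𝓡 n)).symm.continuous.comp
        (continuous_id.prodMk continuous_const)
    refine (h1.comp h2.continuousOn (fun y hy => hy)).congr fun y hy => ?_
    simp [tangentMapWithin, mfderivWithin_of_isOpen e.open_target hy]
  have := isContinuousRiemannianBundle_of_contMDiff (n := n) (EuclideanSpace ℝ (Fin n))
    (fun x : X => TangentSpace (𝓡 n) x)
  have hinner : ∀ v w : EuclideanSpace ℝ (Fin n), ContinuousOn (fun y =>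
      inner ℝ (mfderiv (𝓡 n) (𝓡 n) e.symm y v) (mfderiv (𝓡 n) (𝓡 n) e.symm y w)) e.target :=
    fun v w => (hsec v).inner_bundle (hsec w)
  rw [continuousOn_iff_continuous_domRestrict]
  refine Real.continuous_sqrt.comp (Continuous.matrix_det (continuous_matrix fun i j => ?_))
  exact continuousOn_iff_continuous_domRestrict.1 (hinner (EuclideanSpace.basisFun (Fin n) ℝ i)
    (EuclideanSpace.basisFun (Fin n) ℝ j))

instance isLocallyFiniteMeasure_riemannianVolume :
    IsLocallyFiniteMeasure (riemannianVolume n X) := by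
  refine ⟨fun x => ?_⟩
  set e := chartAt (EuclideanSpace ℝ (Fin n)) x
  have he : e ∈ IsManifold.maximalAtlas (𝓡 n) ∞ X := IsManifold.chart_mem_maximalAtlas x
  have hx : x ∈ e.source := mem_chart_source _ x
  have hcont : ContinuousAt (chartDensity e) (e x) :=
    (continuousOn_chartDensity he).continuousAt (e.open_target.mem_nhds (e.map_source hx))
  have hbd : ∀ᶠ y in 𝓝 (e x), chartDensity e y < chartDensity e (e x) + 1 :=
    hcont.eventually_lt continuousAt_const (by linarith)
  obtain ⟨W, hW, hWo, hxW⟩ := eventually_nhds_iff.1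
    (hbd.and (Metric.ball_mem_nhds (e x) one_pos))
  refine ⟨e.source ∩ e ⁻¹' W, (e.isOpen_inter_preimage hWo).mem_nhds ⟨hx, hxW⟩, ?_⟩
  have hmeas := (e.isOpen_inter_preimage hWo).measurableSet
  have h1 : riemannianVolume n X (e.source ∩ e ⁻¹' W) = chartMeasure e (e.source ∩ e ⁻¹' W) := by
    rw [← riemannianVolume_restrict_source he, Measure.restrict_apply hmeas,
      inter_eq_self_of_subset_left inter_subset_left]
  rw [h1, (chartMeasure_apply e hmeas).2]
  have hsub : e.target ∩ e.symm ⁻¹' (e.source ∩ e ⁻¹' W) ⊆ W := by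
    rintro y ⟨hy, -, hyW⟩
    simpa [e.right_inv hy] using hyW
  calc _ ≤ ∫⁻ y in W, ENNReal.ofReal (chartDensity e y) := lintegral_mono_set hsub
    _ ≤ ∫⁻ y in W, ENNReal.ofReal (chartDensity e (e x) + 1) :=
        setLIntegral_mono measurable_const fun y hy => ENNReal.ofReal_le_ofReal (hW y hy).1.le
    _ = ENNReal.ofReal (chartDensity e (e x) + 1) * volume W := by simp
    _ < ⊤ := ENNReal.mul_lt_top ENNReal.ofReal_lt_top
        ((measure_mono fun y hy => (hW y hy).2).trans_lt measure_ball_lt_top)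

end LocallyFinite

end Volume

section Action

variable (n : ℕ) (G X : Type*) [Group G] [TopologicalSpace X]
  [ChartedSpace (EuclideanSpace ℝ (Fin n)) X] [MulAction G X]

variable {G X} in
/-- The differential at `x` of the map `x ↦ g • x`. -/
def smulDeriv (g : G) (x : X) : TangentSpace (𝓡 n) x →L[ℝ] TangentSpace (𝓡 n) (g • x) :=
  mfderiv (𝓡 n) (𝓡 n) (fun x : X => g • x) x

variable [RiemannianBundle (fun x : X => TangentSpace (𝓡 n) x)]

/-- Every element of `G` acts on the Riemannian manifold `X` by a smooth map whose differential
preserves the Riemannian metric. -/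
class IsRiemannianAction : Prop where
  contMDiff_smul : ∀ g : G, ContMDiff (𝓡 n) (𝓡 n) ∞ (fun x : X => g • x)
  inner_mfderiv : ∀ (g : G) (x : X) (v w : TangentSpace (𝓡 n) x),
    inner ℝ (smulDeriv n g x v) (smulDeriv n g x w) = inner ℝ v w

variable {n G X}
variable [IsManifold (𝓡 n) ∞ X] [IsRiemannianAction n G X] [MeasurableSpace X] [BorelSpace X]

/-- The homeomorphism of `X` given by `g`. -/
def smulHomeo (n : ℕ) {G X : Type*} [Group G] [TopologicalSpace X]
    [ChartedSpace (EuclideanSpace ℝ (Fin n)) X]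
    [RiemannianBundle (fun x : X => TangentSpace (𝓡 n) x)] [MulAction G X]
    [IsRiemannianAction n G X] (g : G) : X ≃ₜ X where
  toEquiv := MulAction.toPerm g
  continuous_toFun := (IsRiemannianAction.contMDiff_smul (n := n) g).continuous
  continuous_invFun := (IsRiemannianAction.contMDiff_smul (n := n) g⁻¹).continuous

theorem riemannianVolume_le_map_smul (g : G) :
    riemannianVolume n X ≤ (riemannianVolume n X).map (fun x => g • x) := by
  have hg := IsRiemannianAction.contMDiff_smul (n := n) (X := X) g
  have hg' := IsRiemannianAction.contMDiff_smul (n := n) (X := X) g⁻¹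
  refine iSup₂_le fun e he => ?_
  let e' := (smulHomeo n g : X ≃ₜ X).transOpenPartialHomeomorph e
  have hsymm : (e'.symm : EuclideanSpace ℝ (Fin n) → X) = fun y => g⁻¹ • e.symm y := rfl
  have he' : e' ∈ IsManifold.maximalAtlas (𝓡 n) ∞ X := by
    rw [IsManifold.mem_maximalAtlas_iff_contMDiffOn]
    constructor
    · exact (contMDiffOn_of_mem_maximalAtlas he).comp hg.contMDiffOn fun x hx => hx
    · exact hg'.comp_contMDiffOn (contMDiffOn_symm_of_mem_maximalAtlas he)
  have hdens : ∀ y ∈ e.target, chartDensity e' y = chartDensity e y := by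
    intro y hy
    have h1 : MDifferentiableAt (𝓡 n) (𝓡 n) e.symm y :=
      (contMDiffAt_symm_of_mem_maximalAtlas he hy).mdifferentiableAt (by simp)
    have h2 : MDifferentiableAt (𝓡 n) (𝓡 n) (fun x : X => g⁻¹ • x) (e.symm y) :=
      hg'.contMDiffAt.mdifferentiableAt (by simp)
    have h3 := mfderiv_comp y h2 h1
    unfold chartDensity volumeFactor
    congr 2
    ext i j
    refine Eq.trans ?_ (IsRiemannianAction.inner_mfderiv (n := n) g⁻¹ (e.symm y)
      (mfderiv (𝓡 n) (𝓡 n) e.symm y (EuclideanSpace.basisFun (Fin n) ℝ i))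
      (mfderiv (𝓡 n) (𝓡 n) e.symm y (EuclideanSpace.basisFun (Fin n) ℝ j)))
    have h4 : ∀ v, mfderiv (𝓡 n) (𝓡 n) e'.symm y v =
      mfderiv (𝓡 n) (𝓡 n) (fun x : X => g⁻¹ • x) (e.symm y)
        (mfderiv (𝓡 n) (𝓡 n) e.symm y v) := fun v => congrArg (fun L => L v) h3
    exact congrArg₂ (inner ℝ) (h4 _) (h4 _)
  have hmap : chartMeasure e = (chartMeasure e').map (fun x => g • x) := by
    ext A hA
    rw [Measure.map_apply hg.continuous.measurable hA, (chartMeasure_apply e hA).2,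
      (chartMeasure_apply e' (hg.continuous.measurable hA)).2]
    have hset : e'.target ∩ e'.symm ⁻¹' ((fun x => g • x) ⁻¹' A) = e.target ∩ e.symm ⁻¹' A := by
      ext y
      simp [hsymm, e']
    rw [hset]
    exact setLIntegral_congr_fun (chartMeasure_apply e hA).1
      fun y hy => by simp only [hdens y hy.1]
  rw [hmap]
  exact Measure.map_mono (le_iSup₂_of_le e' he' le_rfl) hg.continuous.measurable

/-- The Riemannian measure is invariant under isometries. -/
theorem measurePreserving_smul_riemannianVolume (g : G) :
    MeasurePreserving (fun x => g • x) (riemannianVolume n X) (riemannianVolume n X) := by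
  have hm : ∀ g : G, Measurable (fun x : X => g • x) := fun g =>
    (IsRiemannianAction.contMDiff_smul (n := n) (X := X) g).continuous.measurable
  refine ⟨hm g, le_antisymm ?_ (riemannianVolume_le_map_smul g)⟩
  have h := Measure.map_mono (riemannianVolume_le_map_smul (n := n) (X := X) g⁻¹) (hm g)
  rw [Measure.map_map (hm g) (hm g⁻¹)] at h
  simpa [Function.comp_def] using h

end Action

section RealBundle

variable {X : Type*} [TopologicalSpace X] {F : Type*} [NormedAddCommGroup F] [NormedSpace ℂ F]
  {E : X → Type*} [TopologicalSpace (TotalSpace F E)] [∀ x, NormedAddCommGroup (E x)]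
  [∀ x, InnerProductSpace ℂ (E x)] [FiberBundle F E]

/-- A complex vector bundle is a real vector bundle. -/
instance vectorBundle_real [VectorBundle ℂ F E] : VectorBundle ℝ F E where
  trivialization_linear' e _ := by
    refine ⟨fun b hb => ⟨(e.linear ℂ hb).map_add, fun c v => ?_⟩⟩
    exact (e.linear ℂ hb).map_smul (c : ℂ) v
  continuousOn_coordChange' e e' _ _ := by
    have hlin : ∀ (e : Trivialization F (π F E)) [MemTrivializationAtlas e], e.IsLinear ℝ := by
      intro e _
      refine ⟨fun b hb => ⟨(e.linear ℂ hb).map_add, fun c v => ?_⟩⟩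
      exact (e.linear ℂ hb).map_smul (c : ℂ) v
    have h := continuousOn_coordChange ℂ e e'
    have h2 := (ContinuousLinearMap.restrictScalarsL ℂ F F ℝ ℝ).continuous.comp_continuousOn h
    refine h2.congr fun b hb => ?_
    ext v
    have := hlin e
    have := hlin e'
    simp [Trivialization.coordChangeL_apply _ _ hb]

variable [VectorBundle ℂ F E]

theorem continuous_section_smul {φ : X → ℂ} (hφ : Continuous φ) {f : ∀ x, E x}
    (hf : Continuous fun x => (⟨x, f x⟩ : TotalSpace F E)) :
    Continuous fun x => (⟨x, φ x • f x⟩ : TotalSpace F E) := by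
  rw [continuous_iff_continuousAt] at hf ⊢
  intro x
  have h := hf x
  rw [FiberBundle.continuousAt_totalSpace] at h ⊢
  refine ⟨continuousAt_id, (hφ.continuousAt.smul h.2).congr ?_⟩
  filter_upwards [(trivializationAt F E x).open_baseSet.mem_nhds
    (mem_baseSet_trivializationAt F E x)] with y hy
  exact ((Trivialization.linear ℂ (trivializationAt F E x) hy).map_smul _ _).symm

theorem continuous_section_add {f h : ∀ x, E x}
    (hf : Continuous fun x => (⟨x, f x⟩ : TotalSpace F E))
    (hh : Continuous fun x => (⟨x, h x⟩ : TotalSpace F E)) :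
    Continuous fun x => (⟨x, f x + h x⟩ : TotalSpace F E) := by
  rw [continuous_iff_continuousAt] at hf hh ⊢
  intro x
  have h1 := hf x
  have h2 := hh x
  rw [FiberBundle.continuousAt_totalSpace] at h1 h2 ⊢
  refine ⟨continuousAt_id, (h1.2.add h2.2).congr ?_⟩
  filter_upwards [(trivializationAt F E x).open_baseSet.mem_nhds
    (mem_baseSet_trivializationAt F E x)] with y hy
  exact ((Trivialization.linear ℂ (trivializationAt F E x) hy).map_add _ _).symm

theorem continuous_section_zero : Continuous fun x => (⟨x, 0⟩ : TotalSpace F E) := by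
  rw [continuous_iff_continuousAt]
  intro x
  rw [FiberBundle.continuousAt_totalSpace]
  refine ⟨continuousAt_id, (continuousAt_const (y := (0 : F))).congr ?_⟩
  filter_upwards [(trivializationAt F E x).open_baseSet.mem_nhds
    (mem_baseSet_trivializationAt F E x)] with y hy
  exact ((Trivialization.linear ℂ (trivializationAt F E x) hy).map_zero).symm

variable (F E) in
/-- The continuous sections of `E` with compact support, as a subspace of all sections. -/
def ccSubmodule : Submodule ℂ (∀ x, E x) where
  carrier := {f | Continuous (fun x => (⟨x, f x⟩ : TotalSpace F E)) ∧
    IsCompact (closure {x | f x ≠ 0})}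
  zero_mem' := ⟨continuous_section_zero, by simp⟩
  add_mem' := by
    rintro f h ⟨hf, hfc⟩ ⟨hh, hhc⟩
    refine ⟨continuous_section_add hf hh, (hfc.union hhc).of_isClosed_subset isClosed_closure ?_⟩
    rw [← closure_union]
    refine closure_mono fun x hx => ?_
    by_contra hcon
    simp only [mem_union, mem_ofPred_eq, not_or, not_not] at hcon
    exact hx (by simp [hcon.1, hcon.2])
  smul_mem' := by
    rintro c f ⟨hf, hfc⟩
    refine ⟨continuous_section_smul continuous_const hf,
      hfc.of_isClosed_subset isClosed_closure (closure_mono fun x hx hfx => hx ?_)⟩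
    simp [hfx]

end RealBundle

section Hermitian

attribute [local instance] InnerProductSpace.complexToReal

/-- The Hermitian inner products on the fibres of the complex vector bundle `E` depend smoothly on
the base point. This is stated for the real part `Re ⟪v, w⟫`, which determines the imaginary part
`Im ⟪v, w⟫ = Re ⟪i v, w⟫`. -/
class IsSmoothHermitianBundle (n : ℕ) {X : Type*} [TopologicalSpace X]
    [ChartedSpace (EuclideanSpace ℝ (Fin n)) X] (F : Type*) [NormedAddCommGroup F]
    [NormedSpace ℂ F] (E : X → Type*) [TopologicalSpace (TotalSpace F E)]
    [∀ x, NormedAddCommGroup (E x)] [∀ x, InnerProductSpace ℂ (E x)] [FiberBundle F E]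
    [VectorBundle ℂ F E] : Prop where
  smooth_re_inner : IsContMDiffRiemannianBundle (𝓡 n) ∞ F E

end Hermitian

section L2

variable (n : ℕ) {X : Type*} [TopologicalSpace X] (F : Type*) [NormedAddCommGroup F] [NormedSpace ℂ F]
  (E : X → Type*) [TopologicalSpace (TotalSpace F E)] [∀ x, NormedAddCommGroup (E x)]
  [∀ x, InnerProductSpace ℂ (E x)] [FiberBundle F E] [VectorBundle ℂ F E]

/-- `C_c(X, E)`: the continuous compactly supported sections of `E`, with the `L²` inner product
for the Riemannian measure of the `n`-dimensional manifold `X`. -/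
def CcSection (_n : ℕ) {X : Type*} [TopologicalSpace X] (F : Type*) [NormedAddCommGroup F]
    [NormedSpace ℂ F] (E : X → Type*) [TopologicalSpace (TotalSpace F E)]
    [∀ x, NormedAddCommGroup (E x)] [∀ x, InnerProductSpace ℂ (E x)] [FiberBundle F E]
    [VectorBundle ℂ F E] : Type _ := ccSubmodule F E

namespace CcSection

instance : AddCommGroup (CcSection n F E) := inferInstanceAs (AddCommGroup (ccSubmodule F E))

instance : Module ℂ (CcSection n F E) := inferInstanceAs (Module ℂ (ccSubmodule F E))

variable {n F E}

/-- The underlying section. -/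
def toFun (f : CcSection n F E) : ∀ x, E x := Subtype.val (p := (· ∈ ccSubmodule F E)) f

instance : CoeFun (CcSection n F E) (fun _ => ∀ x, E x) := ⟨toFun⟩

variable (n) in
/-- A continuous section with compact support, as an element of `C_c(X, E)`. -/
def mk (f : ∀ x, E x) (hf : Continuous fun x => (⟨x, f x⟩ : TotalSpace F E))
    (hc : IsCompact (closure {x | f x ≠ 0})) : CcSection n F E :=
  (⟨f, hf, hc⟩ : ccSubmodule F E)

theorem mk_apply (f : ∀ x, E x) (hf : Continuous fun x => (⟨x, f x⟩ : TotalSpace F E))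
    (hc : IsCompact (closure {x | f x ≠ 0})) (x : X) : mk n f hf hc x = f x := rfl

theorem continuous (f : CcSection n F E) : Continuous fun x => (⟨x, f x⟩ : TotalSpace F E) :=
  (Subtype.property (p := (· ∈ ccSubmodule F E)) f).1

theorem isCompact (f : CcSection n F E) : IsCompact (closure {x | f x ≠ 0}) :=
  (Subtype.property (p := (· ∈ ccSubmodule F E)) f).2

theorem ext {f h : CcSection n F E} (H : ∀ x, f x = h x) : f = h := Subtype.ext (funext H)

theorem add_apply (f h : CcSection n F E) (x : X) : (f + h) x = f x + h x := rfl

theorem smul_apply (c : ℂ) (f : CcSection n F E) (x : X) : (c • f) x = c • f x := rfl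

/-- Multiplication of sections by a continuous compactly supported function. -/
def mulLinear (φ : CompactlySupportedContinuousMap X ℂ) :
    CcSection n F E →ₗ[ℂ] CcSection n F E where
  toFun f := mk n (fun x => φ x • f x) (continuous_section_smul φ.continuous f.continuous)
    (f.isCompact.of_isClosed_subset isClosed_closure 
      (closure_mono fun x hx hfx => hx (by simp [hfx])))
  map_add' f h := ext fun x => smul_add _ _ _
  map_smul' c f := ext fun x => smul_comm _ _ _

theorem mulLinear_apply (φ : CompactlySupportedContinuousMap X ℂ) (f : CcSection n F E) (x : X) :
    mulLinear φ f x = φ x • f x := rfl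

variable [ChartedSpace (EuclideanSpace ℝ (Fin n)) X] [hE : IsSmoothHermitianBundle n F E]

theorem continuous_inner (f h : CcSection n F E) :
    Continuous fun x => inner ℂ (f x) (h x) := by
  let _ : ∀ x, InnerProductSpace ℝ (E x) := fun x => InnerProductSpace.complexToReal
  have := hE.smooth_re_inner
  have := isContinuousRiemannianBundle_of_contMDiff (n := n) F E
  have h1 : Continuous fun x => inner ℝ (f x) (h x) := f.continuous.inner_bundle h.continuous
  have h2 : Continuous fun x => inner ℝ ((Complex.I • f) x) (h x) :=
    (Complex.I • f).continuous.inner_bundle h.continuous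
  have h3 : (fun x => inner ℂ (f x) (h x)) = fun x =>
      ((inner ℝ (f x) (h x) : ℝ) : ℂ) + ((inner ℝ ((Complex.I • f) x) (h x) : ℝ) : ℂ) * Complex.I := by
    funext x
    have e1 : inner ℝ (f x) (h x) = (inner ℂ (f x) (h x)).re := rfl
    have e2 : inner ℝ ((Complex.I • f) x) (h x) = (inner ℂ (Complex.I • f x) (h x)).re := rfl
    rw [e1, e2, inner_smul_left]
    apply Complex.ext <;> simp
  rw [h3]
  exact (Complex.continuous_ofReal.comp h1).add
    ((Complex.continuous_ofReal.comp h2).mul continuous_const)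

variable [IsManifold (𝓡 n) ∞ X] [RiemannianBundle (fun x : X => TangentSpace (𝓡 n) x)]
  [IsContMDiffRiemannianBundle (𝓡 n) ∞ (EuclideanSpace ℝ (Fin n))
    (fun x : X => TangentSpace (𝓡 n) x)]
  [MeasurableSpace X] [BorelSpace X]

theorem integrable_inner (f h : CcSection n F E) :
    Integrable (fun x => inner ℂ (f x) (h x)) (riemannianVolume n X) := by
  refine (continuous_inner f h).integrable_of_hasCompactSupport ?_
  refine f.isCompact.of_isClosed_subset isClosed_closure (closure_mono fun x hx hfx => hx ?_)
  simp [hfx]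

variable (n F E) in
/-- The inner product `∫ ⟪f x, h x⟫ dx` on `C_c(X, E)`. -/
@[reducible]
def innerCore : PreInnerProductSpace.Core ℂ (CcSection n F E) where
  inner f h := ∫ x, inner ℂ (f x) (h x) ∂(riemannianVolume n X)
  conj_inner_symm f h := by
    rw [← integral_conj]
    simp
  re_inner_nonneg f := by
    rw [← integral_re (integrable_inner f f)]
    exact integral_nonneg fun x => inner_self_nonneg
  add_left f h k := by
    simp only [add_apply, inner_add_left]
    exact integral_add (integrable_inner f k) (integrable_inner h k)
  smul_left f h c := by
    simp only [smul_apply, inner_smul_left]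
    exact integral_const_mul _ _

instance : SeminormedAddCommGroup (CcSection n F E) :=
  @InnerProductSpace.Core.toSeminormedAddCommGroup ℂ _ _ _ _ (innerCore n F E)

instance : InnerProductSpace ℂ (CcSection n F E) :=
  InnerProductSpace.ofCore (innerCore n F E)

theorem inner_def (f h : CcSection n F E) :
    inner ℂ f h = ∫ x, inner ℂ (f x) (h x) ∂(riemannianVolume n X) := rfl

theorem norm_sq_eq (f : CcSection n F E) :
    ‖f‖ ^ 2 = ∫ x, ‖f x‖ ^ 2 ∂(riemannianVolume n X) := by
  rw [← inner_self_eq_norm_sq (𝕜 := ℂ), inner_def, ← integral_re (integrable_inner f f)]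
  simp only [inner_self_eq_norm_sq]

theorem integrable_norm_sq (f : CcSection n F E) :
    Integrable (fun x => ‖f x‖ ^ 2) (riemannianVolume n X) := by
  simpa only [inner_self_eq_norm_sq] using (integrable_inner f f).re

theorem exists_norm_mulLinear_le (φ : CompactlySupportedContinuousMap X ℂ) :
    ∃ C, ∀ f : CcSection n F E, ‖mulLinear φ f‖ ≤ C * ‖f‖ := by
  obtain ⟨C, hC⟩ := φ.hasCompactSupport.exists_bound_of_continuous φ.continuous
  refine ⟨|C|, fun f => abs_le_of_sq_le_sq' ?_ (by positivity) |>.2⟩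
  rw [mul_pow, norm_sq_eq, norm_sq_eq, ← integral_const_mul]
  refine integral_mono (integrable_norm_sq _) ((integrable_norm_sq f).const_mul _) fun x => ?_
  simp only [mulLinear_apply, norm_smul, mul_pow]
  gcongr
  exact (hC x).trans (le_abs_self C)

end CcSection

variable [ChartedSpace (EuclideanSpace ℝ (Fin n)) X] [IsSmoothHermitianBundle n F E]
  [IsManifold (𝓡 n) ∞ X] [RiemannianBundle (fun x : X => TangentSpace (𝓡 n) x)]
  [IsContMDiffRiemannianBundle (𝓡 n) ∞ (EuclideanSpace ℝ (Fin n))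
    (fun x : X => TangentSpace (𝓡 n) x)]
  [MeasurableSpace X] [BorelSpace X]

/-- `L²(X, E)`: the completion of `C_c(X, E)` for the `L²` inner product. -/
abbrev L2 : Type _ := UniformSpace.Completion (CcSection n F E)

variable {F E} in
/-- Multiplication by `φ` as a bounded operator on `C_c(X, E)`. -/
def mulCc (φ : CompactlySupportedContinuousMap X ℂ) : CcSection n F E →L[ℂ] CcSection n F E :=
  (CcSection.mulLinear φ).mkContinuousOfExistsBound (CcSection.exists_norm_mulLinear_le φ)

variable {F E} in
/-- The bounded operator on `L²(X, E)` of pointwise multiplication by `φ`. -/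
def mulOp (φ : CompactlySupportedContinuousMap X ℂ) : L2 n F E →L[ℂ] L2 n F E :=
  (mulCc n φ).completion

end L2

section GBundle

theorem mk_cast {X F : Type*} {E : X → Type*} {x y : X} (h : y = x) (v : E y) :
    (⟨x, h ▸ v⟩ : TotalSpace F E) = ⟨y, v⟩ := by
  subst h; rfl

theorem cast_add {X : Type*} {E : X → Type*} [∀ x, AddCommGroup (E x)] {x y : X} (h : y = x) (v w : E y) :
    (h ▸ (v + w) : E x) = h ▸ v + h ▸ w := by
  subst h; rfl

theorem cast_smul {X : Type*} {E : X → Type*} [∀ x, AddCommGroup (E x)] [∀ x, Module ℂ (E x)]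
    {x y : X} (h : y = x) (c : ℂ) (v : E y) :
    (h ▸ (c • v) : E x) = c • (h ▸ v) := by
  subst h; rfl

theorem inner_cast {X : Type*} {E : X → Type*} [∀ x, Inner ℂ (E x)] {x y : X} (h : y = x) (v w : E y) :
    inner ℂ (h ▸ v : E x) (h ▸ w) = inner ℂ v w := by
  subst h; rfl

/-- A structure of smooth Hermitian `G`-vector bundle on `E`: an action of `G` on the total space of
`E`, continuous in all variables and smooth for each `g`, given by complex linear isometries
`E x → E (g • x)` of the fibres. -/
class HermitianGBundle (n : ℕ) (G : Type*) [Group G] [TopologicalSpace G]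
    {X : Type*} [TopologicalSpace X] [ChartedSpace (EuclideanSpace ℝ (Fin n)) X] [MulAction G X]
    (F : Type*) [NormedAddCommGroup F] [NormedSpace ℂ F]
    (E : X → Type*) [TopologicalSpace (TotalSpace F E)] [∀ x, NormedAddCommGroup (E x)]
    [∀ x, InnerProductSpace ℂ (E x)] [FiberBundle F E] [VectorBundle ℂ F E] where
  fiberMap : ∀ (g : G) (x : X), E x →ₗ[ℂ] E (g • x)
  one_smul' : ∀ (x : X) (v : E x),
    (⟨(1 : G) • x, fiberMap 1 x v⟩ : TotalSpace F E) = ⟨x, v⟩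
  mul_smul' : ∀ (g h : G) (x : X) (v : E x),
    (⟨(g * h) • x, fiberMap (g * h) x v⟩ : TotalSpace F E) =
      ⟨g • h • x, fiberMap g (h • x) (fiberMap h x v)⟩
  continuous_smul' : Continuous fun p : G × TotalSpace F E =>
    (⟨p.1 • p.2.proj, fiberMap p.1 p.2.proj p.2.snd⟩ : TotalSpace F E)
  contMDiff_smul' : ∀ g : G, ContMDiff ((𝓡 n).prod 𝓘(ℝ, F)) ((𝓡 n).prod 𝓘(ℝ, F)) ∞
    fun p : TotalSpace F E => (⟨g • p.proj, fiberMap g p.proj p.snd⟩ : TotalSpace F E)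
  inner_fiberMap : ∀ (g : G) (x : X) (v w : E x),
    inner ℂ (fiberMap g x v) (fiberMap g x w) = inner ℂ v w

variable (n : ℕ) {G : Type*} [Group G] [TopologicalSpace G]
  {X : Type*} [TopologicalSpace X] [ChartedSpace (EuclideanSpace ℝ (Fin n)) X] [MulAction G X]
  {F : Type*} [NormedAddCommGroup F] [NormedSpace ℂ F]
  {E : X → Type*} [TopologicalSpace (TotalSpace F E)] [∀ x, NormedAddCommGroup (E x)]
  [∀ x, InnerProductSpace ℂ (E x)] [FiberBundle F E] [VectorBundle ℂ F E]
  [hG : HermitianGBundle n G F E]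

/-- The action of `g` on sections: `(g · f) x = g (f (g⁻¹ x))`. -/
def translateFun (g : G) (f : ∀ x, E x) (x : X) : E x :=
  smul_inv_smul g x ▸ hG.fiberMap g (g⁻¹ • x) (f (g⁻¹ • x))

variable [RiemannianBundle (fun x : X => TangentSpace (𝓡 n) x)] [IsRiemannianAction n G X]

/-- The action of `g` on `C_c(X, E)`. -/
def translateLinear (g : G) : CcSection n F E →ₗ[ℂ] CcSection n F E where
  toFun f := CcSection.mk n (translateFun n (F := F) g f) (by
      have h1 : Continuous fun x : X => (⟨g⁻¹ • x, f (g⁻¹ • x)⟩ : TotalSpace F E) :=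
        f.continuous.comp (smulHomeo n g⁻¹ : X ≃ₜ X).continuous
      have h2 := hG.continuous_smul'.comp (continuous_const (y := g) |>.prodMk h1)
      refine h2.congr fun x => ?_
      exact (mk_cast (smul_inv_smul g x) _).symm) (by
      refine (f.isCompact.image (smulHomeo n g : X ≃ₜ X).continuous).of_isClosed_subset
        isClosed_closure ?_
      rw [(smulHomeo n g : X ≃ₜ X).image_closure]
      refine closure_mono fun x hx => ⟨g⁻¹ • x, fun hfx => hx ?_, smul_inv_smul g x⟩
      rw [translateFun, hfx, map_zero]
      have h0 := cast_smul (E := E) (smul_inv_smul g x) 0 0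
      simpa using h0)
  map_add' f h := CcSection.ext fun x => by
    change translateFun n (F := F) g (fun x => f x + h x) x =
      translateFun n (F := F) g f x + translateFun n (F := F) g h x
    simp only [translateFun, map_add, cast_add]
  map_smul' c f := CcSection.ext fun x => by
    change translateFun n (F := F) g (fun x => c • f x) x = c • translateFun n (F := F) g f x
    simp only [translateFun, map_smul, cast_smul]

theorem translateLinear_apply (g : G) (f : CcSection n F E) (x : X) :
    translateLinear n g f x = translateFun n (F := F) g f x := rfl

variable [IsSmoothHermitianBundle n F E] [IsManifold (𝓡 n) ∞ X]
  [IsContMDiffRiemannianBundle (𝓡 n) ∞ (EuclideanSpace ℝ (Fin n))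
    (fun x : X => TangentSpace (𝓡 n) x)]
  [MeasurableSpace X] [BorelSpace X]

theorem norm_translateLinear (g : G) (f : CcSection n F E) : ‖translateLinear n g f‖ = ‖f‖ := by
  have h1 : inner ℂ (translateLinear n g f) (translateLinear n g f) = inner ℂ f f := by
    rw [CcSection.inner_def, CcSection.inner_def]
    simp only [translateLinear_apply, translateFun, inner_cast, hG.inner_fiberMap]
    exact (measurePreserving_smul_riemannianVolume (n := n) (X := X) g⁻¹).integral_comp
      (smulHomeo n g⁻¹ : X ≃ₜ X).measurableEmbedding fun x => inner ℂ (f x) (f x)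
  rw [norm_eq_sqrt_re_inner (𝕜 := ℂ), norm_eq_sqrt_re_inner (𝕜 := ℂ), h1]

/-- The action of `g` as an isometry of `C_c(X, E)`. -/
def translateCc (g : G) : CcSection n F E →ₗᵢ[ℂ] CcSection n F E :=
  ⟨translateLinear n g, norm_translateLinear n g⟩

variable (F E) in
/-- The unitary action of `g` on `L²(X, E)`, extending `(g · f) x = g (f (g⁻¹ x))`. -/
def translateOp (g : G) : L2 n F E →L[ℂ] L2 n F E :=
  (translateCc n g).toContinuousLinearMap.completion

end GBundle

section TraceClass

variable {H : Type*} [NormedAddCommGroup H] [InnerProductSpace ℂ H] [CompleteSpace H]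

/-- The absolute value `|T| = (T* T)^(1/2)`. -/
def operatorAbs (T : H →L[ℂ] H) : H →L[ℂ] H := CFC.abs T

/-- `T` is of trace class: `∑ ⟪|T| eᵢ, eᵢ⟫ < ∞` for an orthonormal basis `(eᵢ)`. -/
def IsTraceClass (T : H →L[ℂ] H) : Prop :=
  ∃ (s : Set H) (b : HilbertBasis s ℂ H), Summable fun i => ‖inner ℂ (b i) (operatorAbs T (b i))‖

/-- `t` is the trace of `T`: `∑ ⟪T eᵢ, eᵢ⟫ = t`, with an absolutely convergent sum, for every
orthonormal basis `(eᵢ)`. -/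
def HasTrace (T : H →L[ℂ] H) (t : ℂ) : Prop :=
  ∀ (s : Set H) (b : HilbertBasis s ℂ H), HasSum (fun i => inner ℂ (b i) (T (b i))) t

variable (H) in
/-- An orthonormal basis of the Hilbert space `H`. -/
def someHilbertBasis : HilbertBasis (exists_hilbertBasis ℂ H).choose ℂ H :=
  (exists_hilbertBasis ℂ H).choose_spec.choose

/-- The trace `∑ ⟪T eᵢ, eᵢ⟫` of a trace class operator `T`, for an orthonormal basis `(eᵢ)`. -/
def trace (T : H →L[ℂ] H) : ℂ :=
  ∑' i, inner ℂ (someHilbertBasis H i) (T (someHilbertBasis H i))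

end TraceClass

section GTraceClass

variable (n : ℕ) {G : Type*} [Group G] [TopologicalSpace G]
  {X : Type*} [TopologicalSpace X] [ChartedSpace (EuclideanSpace ℝ (Fin n)) X] [MulAction G X]

/-- A real function, as a complex one. -/
def toComplex (c : CompactlySupportedContinuousMap X ℝ) : CompactlySupportedContinuousMap X ℂ where
  toFun x := (c x : ℂ)
  continuous_toFun := Complex.continuous_ofReal.comp c.continuous
  hasCompactSupport' := c.hasCompactSupport.comp_left (g := ((↑) : ℝ → ℂ)) Complex.ofReal_zero

/-- `c ∈ C_c^∞(X)` is a cutoff function: `c ≥ 0` and `∫_G c (g⁻¹ x) dg = 1` for all `x`. -/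
structure IsCutoff [MeasurableSpace G] (μ : Measure G)
    (c : CompactlySupportedContinuousMap X ℝ) : Prop where
  smooth : ContMDiff (𝓡 n) 𝓘(ℝ, ℝ) ∞ c
  nonneg : ∀ x, 0 ≤ c x
  integral_eq_one : ∀ x, ∫ g, c (g⁻¹ • x) ∂μ = 1

/-- `c₁, c₂ ∈ C_c^∞(X)` are nonnegative functions whose product is a cutoff function. -/
structure IsCutoffPair [MeasurableSpace G] (μ : Measure G)
    (c₁ c₂ : CompactlySupportedContinuousMap X ℝ) : Prop where
  smooth₁ : ContMDiff (𝓡 n) 𝓘(ℝ, ℝ) ∞ c₁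
  smooth₂ : ContMDiff (𝓡 n) 𝓘(ℝ, ℝ) ∞ c₂
  nonneg₁ : ∀ x, 0 ≤ c₁ x
  nonneg₂ : ∀ x, 0 ≤ c₂ x
  isCutoff : IsCutoff n μ (c₁ * c₂)

variable {F : Type*} [NormedAddCommGroup F] [NormedSpace ℂ F]
  {E : X → Type*} [TopologicalSpace (TotalSpace F E)] [∀ x, NormedAddCommGroup (E x)]
  [∀ x, InnerProductSpace ℂ (E x)] [FiberBundle F E] [VectorBundle ℂ F E]
  [RiemannianBundle (fun x : X => TangentSpace (𝓡 n) x)]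
  [IsSmoothHermitianBundle n F E] [IsManifold (𝓡 n) ∞ X]
  [IsContMDiffRiemannianBundle (𝓡 n) ∞ (EuclideanSpace ℝ (Fin n))
    (fun x : X => TangentSpace (𝓡 n) x)]
  [MeasurableSpace X] [BorelSpace X]

/-- The operator `c₁ S c₂` on `L²(X, E)`, where a function stands for the multiplication by it. -/
def sandwich (c₁ : CompactlySupportedContinuousMap X ℝ) (S : L2 n F E →L[ℂ] L2 n F E)
    (c₂ : CompactlySupportedContinuousMap X ℝ) : L2 n F E →L[ℂ] L2 n F E :=
  mulOp n (toComplex c₁) ∘L S ∘L mulOp n (toComplex c₂)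

variable (G) in
/-- The bounded operator `S` on `L²(X, E)` commutes with the action of `G`. -/
def IsGInvariant [IsRiemannianAction n G X] [HermitianGBundle n G F E]
    (S : L2 n F E →L[ℂ] L2 n F E) : Prop :=
  ∀ g : G, translateOp n F E g ∘L S = S ∘L translateOp n F E g

variable (G) in
/-- `S` is of `G`-trace class: it is a bounded `G`-invariant operator and `φ |S| ψ` is of trace class
for all `φ, ψ ∈ C_c^∞(X)`. -/
structure IsGTraceClass [IsRiemannianAction n G X] [HermitianGBundle n G F E]
    (S : L2 n F E →L[ℂ] L2 n F E) : Prop where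
  invariant : IsGInvariant n G S
  isTraceClass : ∀ φ ψ : CompactlySupportedContinuousMap X ℂ,
    ContMDiff (𝓡 n) 𝓘(ℝ, ℂ) ∞ φ → ContMDiff (𝓡 n) 𝓘(ℝ, ℂ) ∞ ψ →
      IsTraceClass (mulOp n φ ∘L operatorAbs S ∘L mulOp n ψ)

open Classical in
/-- The `G`-trace `tr_G S = tr (c₁ S c₂)`, computed with some pair `c₁, c₂` of nonnegative functions
in `C_c^∞(X)` whose product is a cutoff function. -/
def gTrace [MeasurableSpace G] (μ : Measure G) (S : L2 n F E →L[ℂ] L2 n F E) : ℂ :=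
  if h : ∃ p : CompactlySupportedContinuousMap X ℝ × CompactlySupportedContinuousMap X ℝ,
      IsCutoffPair n μ p.1 p.2 then
    trace (sandwich n h.choose.1 S h.choose.2)
  else 0

end GTraceClass

end GTrace

end

/-! Write `S = A²` with `A = √S`, which is self-adjoint and again commutes with `G`. For smooth
compactly supported real `χ`, the operator `χ S χ = (A χ)* (A χ)` is of trace class, so `A χ` is
Hilbert–Schmidt, and so is its adjoint `χ A`. Hence `f A` is Hilbert–Schmidt for every real `f ∈
C_c(X)`, as `f = f χ` for a suitable `χ`.

Consequently `c₁ S c₂ = (c₁ A)(A c₂)` is a product of two Hilbert–Schmidt operators. Its trace can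
be moved around cyclically and equals `τ(c₁ c₂)`, where `τ(f) = ∑ ⟪A bᵢ, f A bᵢ⟫`
(`hasSum_sandwich_localTrace`). Only the product `c₁ c₂` enters.

The functional `τ` is positive on `C_c(X)`, does not depend on the basis, and is `G`-invariant:
translating `f` amounts to translating the basis, because `A` commutes with `G`
(`localTrace_translateCompact`). By the Riesz theorem `τ` is integration against an invariant
measure `m`. For cutoff functions `c` and `d`, Fubini, invariance of `m` and unimodularity give `∫ c
dm = ∬ d(g⁻¹x) c(x) dg dm = ∬ d(x) c(gx) dg dm = ∫ d dm`, which is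
`eq_of_integral_translate_eq_one`. -/

noncomputable section

namespace GTrace

open Set Filter Topology

/-! ### Hilbert–Schmidt operators and traces of their products -/

section HilbertSchmidt

variable {H : Type*} [NormedAddCommGroup H] [InnerProductSpace ℂ H]
  {ι κ : Type*}

theorem hasSum_norm_inner_sq (e : HilbertBasis κ ℂ H) (x : H) :
    HasSum (fun j => ‖inner ℂ (e j) x‖ ^ 2) (‖x‖ ^ 2) := by
  have h := Complex.hasSum_re (e.hasSum_inner_mul_inner x x)
  rw [show (inner ℂ x x).re = ‖x‖ ^ 2 from inner_self_eq_norm_sq (𝕜 := ℂ) x] at h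
  convert h using 2 with j
  rw [← inner_conj_symm x (e j), Complex.conj_mul', ← Complex.ofReal_pow, Complex.ofReal_re]

/-- By Parseval each row of the matrix of `K` sums to `‖K bᵢ‖²`. Square summability of the whole
matrix is what permits exchanging the two bases. -/
theorem summable_prod_norm_inner_sq (b : HilbertBasis ι ℂ H) (e : HilbertBasis κ ℂ H)
    {K : H →L[ℂ] H} (hK : Summable fun i => ‖K (b i)‖ ^ 2) :
    Summable fun p : ι × κ => ‖inner ℂ (e p.2) (K (b p.1))‖ ^ 2 := by
  refine (summable_prod_of_nonneg fun p => sq_nonneg _).2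
    ⟨fun i => (hasSum_norm_inner_sq e (K (b i))).summable, ?_⟩
  exact hK.congr fun i => (hasSum_norm_inner_sq e (K (b i))).tsum_eq.symm

theorem summable_inner_of_summable_norm_sq {u v : ι → H} (hu : Summable fun i => ‖u i‖ ^ 2)
    (hv : Summable fun i => ‖v i‖ ^ 2) : Summable fun i => inner ℂ (u i) (v i) := by
  refine .of_norm_bounded (hu.add hv) fun i => (norm_inner_le_norm _ _).trans ?_
  nlinarith [sq_nonneg (‖u i‖ - ‖v i‖), sq_nonneg ‖u i‖, sq_nonneg ‖v i‖]

theorem summable_norm_clm_sq {u : ι → H} (hu : Summable fun i => ‖u i‖ ^ 2) (B : H →L[ℂ] H) :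
    Summable fun i => ‖B (u i)‖ ^ 2 := by
  refine .of_nonneg_of_le (fun _ => by positivity) (fun i => ?_) (hu.mul_left (‖B‖ ^ 2))
  rw [← mul_pow]
  exact pow_le_pow_left₀ (norm_nonneg _) (B.le_opNorm _) 2

variable [CompleteSpace H]

/-- The adjoint of a Hilbert–Schmidt operator is Hilbert–Schmidt, in any orthonormal basis. -/
theorem summable_norm_adjoint_sq (b : HilbertBasis ι ℂ H) (e : HilbertBasis κ ℂ H)
    {K : H →L[ℂ] H} (hK : Summable fun i => ‖K (b i)‖ ^ 2) :
    Summable fun j => ‖K.adjoint (e j)‖ ^ 2 := by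
  -- Summing the same matrix by columns gives the squared norms of `K* eⱼ`.
  have h := (summable_prod_norm_inner_sq b e hK).prod_symm.prod
  refine h.congr fun j => ?_
  rw [← (hasSum_norm_inner_sq b (K.adjoint (e j))).tsum_eq]
  refine tsum_congr fun i => ?_
  rw [ContinuousLinearMap.adjoint_inner_right, ← norm_inner_symm]
  rfl

/-- The Hilbert–Schmidt inner product of `K` and `L` is that of their adjoints, computed in any two
orthonormal bases. -/
theorem tsum_inner_eq_tsum_inner_adjoint (b : HilbertBasis ι ℂ H) (e : HilbertBasis κ ℂ H)
    {K L : H →L[ℂ] H} (hK : Summable fun i => ‖K (b i)‖ ^ 2)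
    (hL : Summable fun i => ‖L (b i)‖ ^ 2) :
    ∑' i, inner ℂ (K (b i)) (L (b i)) = ∑' j, inner ℂ (L.adjoint (e j)) (K.adjoint (e j)) := by
  -- Absolute summability of the double series, from `|ab| ≤ |a|² + |b|²`, justifies the interchange
  -- below.
  have hs : Summable (Function.uncurry fun (i : ι) (j : κ) =>
      inner ℂ (K (b i)) (e j) * inner ℂ (e j) (L (b i))) := by
    refine .of_norm_bounded ((summable_prod_norm_inner_sq b e hK).add
      (summable_prod_norm_inner_sq b e hL)) fun p => ?_
    rw [Function.uncurry, norm_mul, norm_inner_symm]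
    nlinarith [sq_nonneg (‖inner ℂ (e p.2) (K (b p.1))‖ - ‖inner ℂ (e p.2) (L (b p.1))‖),
      sq_nonneg (‖inner ℂ (e p.2) (K (b p.1))‖), sq_nonneg (‖inner ℂ (e p.2) (L (b p.1))‖)]
  calc _ = ∑' (i) (j), inner ℂ (K (b i)) (e j) * inner ℂ (e j) (L (b i)) :=
        tsum_congr fun i => (e.hasSum_inner_mul_inner _ _).tsum_eq.symm
    _ = ∑' (j) (i), inner ℂ (K (b i)) (e j) * inner ℂ (e j) (L (b i)) := hs.tsum_comm.symm
    _ = _ := tsum_congr fun j => by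
        rw [← (b.hasSum_inner_mul_inner (L.adjoint (e j)) (K.adjoint (e j))).tsum_eq]
        refine tsum_congr fun i => ?_
        rw [ContinuousLinearMap.adjoint_inner_left, ContinuousLinearMap.adjoint_inner_right,
          mul_comm]

theorem operatorAbs_of_isPositive {T : H →L[ℂ] H} (hT : T.IsPositive) : operatorAbs T = T :=
  CFC.abs_of_nonneg T ((ContinuousLinearMap.nonneg_iff_isPositive T).2 hT)

/-- If `A` is self-adjoint and `B A² B` is of trace class with `B` self-adjoint, then `A B` is
Hilbert–Schmidt. -/
theorem exists_summable_norm_sq_of_isTraceClass {A B : H →L[ℂ] H} (hA : IsSelfAdjoint A)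
    (hB : IsSelfAdjoint B) (h : IsTraceClass (B ∘L (A ∘L A) ∘L B)) :
    ∃ (s : Set H) (b : HilbertBasis s ℂ H), Summable fun i => ‖A (B (b i))‖ ^ 2 := by
  -- This form shows that the operator is its own absolute value and that its diagonal coefficients
  -- are `‖A B bᵢ‖²`.
  have heq : B ∘L (A ∘L A) ∘L B = (A ∘L B).adjoint ∘L (A ∘L B) := by
    rw [ContinuousLinearMap.adjoint_comp, hA.adjoint_eq, hB.adjoint_eq]
    rfl
  have hpos : (B ∘L (A ∘L A) ∘L B).IsPositive :=
    heq ▸ ContinuousLinearMap.isPositive_adjoint_comp_self _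
  obtain ⟨s, b, hb⟩ := h
  refine ⟨s, b, hb.congr fun i => ?_⟩
  rw [operatorAbs_of_isPositive hpos, heq, ContinuousLinearMap.comp_apply,
    ContinuousLinearMap.adjoint_inner_right,
    inner_self_eq_norm_sq_to_K, norm_pow]
  simp

/-- If `M A` and `N A` are Hilbert–Schmidt, with `A`, `M`, `N` self-adjoint, then the trace of
`M A² N` is `∑ ⟪A bⱼ, N M A bⱼ⟫`, in any orthonormal basis `(bⱼ)`. -/
theorem hasSum_inner_comp {A M N : H →L[ℂ] H} (hA : IsSelfAdjoint A) (hM : IsSelfAdjoint M)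
    (hN : IsSelfAdjoint N) (e : HilbertBasis ι ℂ H) (b : HilbertBasis κ ℂ H)
    (hMA : Summable fun j => ‖M (A (b j))‖ ^ 2) (hNA : Summable fun j => ‖N (A (b j))‖ ^ 2) :
    HasSum (fun i => inner ℂ (e i) ((M ∘L (A ∘L A) ∘L N) (e i)))
      (∑' j, inner ℂ (A (b j)) (N (M (A (b j))))) := by
  have hadj : ∀ B : H →L[ℂ] H, IsSelfAdjoint B → (B ∘L A).adjoint = A ∘L B := fun B hB => by
    rw [ContinuousLinearMap.adjoint_comp, hA.adjoint_eq, hB.adjoint_eq]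
  have hsymm : ∀ B : H →L[ℂ] H, IsSelfAdjoint B → ∀ x y, inner ℂ (B x) y = inner ℂ x (B y) :=
    fun B hB => ContinuousLinearMap.isSelfAdjoint_iff_isSymmetric.1 hB
  have h1 := summable_norm_adjoint_sq (K := M ∘L A) b e hMA
  have h2 := summable_norm_adjoint_sq (K := N ∘L A) b e hNA
  -- The adjoints are `A N` and `A M`, so the side over `e` is `∑ ⟪A M eⱼ, A N eⱼ⟫`, the diagonal
  -- sum of `M A² N`.
  have h3 := tsum_inner_eq_tsum_inner_adjoint (K := N ∘L A) (L := M ∘L A) b e hNA hMA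
  rw [hadj M hM] at h1 h3
  rw [hadj N hN] at h2 h3
  have h4 := (summable_inner_of_summable_norm_sq h1 h2).hasSum
  rw [← h3] at h4
  simp only [ContinuousLinearMap.comp_apply, hsymm A hA, hsymm M hM, hsymm N hN] at h4 ⊢
  exact h4

end HilbertSchmidt

/-! ### Unimodularity and inversion -/

section Haar

variable {G : Type*} [Group G] [TopologicalSpace G] [IsTopologicalGroup G] [MeasurableSpace G]
  [BorelSpace G]

/-- A bi-invariant Haar measure is invariant under inversion, when tested on continuous functions
with compact support. -/
theorem integral_inv_eq_self_of_hasCompactSupport (μ : Measure G) [μ.IsHaarMeasure]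
    [μ.IsMulRightInvariant] {f : G → ℝ} (hf : Continuous f) (hc : HasCompactSupport f) :
    ∫ g, f g⁻¹ ∂μ = ∫ g, f g ∂μ := by
  -- Inversion turns right invariance of `μ` into left invariance of `μ.inv`, so by uniqueness of
  -- Haar measure the two agree on `C_c(G)` up to a factor `k`.
  set k := μ.inv.haarScalarFactor μ
  have : IsFiniteMeasureOnCompacts μ.inv := by
    refine ⟨fun K hK => ?_⟩
    rw [Measure.inv_apply]
    exact hK.inv.measure_lt_top
  have key : ∀ f : G → ℝ, Continuous f → HasCompactSupport f →
      ∫ g, f g⁻¹ ∂μ = k * ∫ g, f g ∂μ := by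
    intro f hf hc
    have h := Measure.integral_isMulLeftInvariant_eq_smul_of_hasCompactSupport μ.inv μ hf hc
    rw [integral_smul_nnreal_measure] at h
    rw [← smul_eq_mul, ← NNReal.smul_def, ← h]
    exact ((Homeomorph.inv G).measurableEmbedding.integral_map f).symm
  have h1 := key f hf hc
  -- Inverting twice gives `k² = 1` unless the integral of `f` vanishes, in which case the claim is
  -- immediate.
  have h2 := key (fun g => f g⁻¹) (hf.comp continuous_inv) (hc.comp_homeomorph (Homeomorph.inv G))
  simp only [inv_inv] at h2
  rcases eq_or_ne (∫ g, f g ∂μ) 0 with h0 | h0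
  · rw [h1, h0, mul_zero]
  · have h3 : (k : ℝ) * k = 1 := by
      rw [h1, ← mul_assoc] at h2
      exact (mul_right_cancel₀ h0 (by rw [one_mul]; exact h2)).symm
    have h4 : (k : ℝ) = 1 := by nlinarith [k.coe_nonneg]
    rw [h1, h4, one_mul]

end Haar

/-! ### Real functions as multipliers and smooth bump functions -/

section ToComplex

variable {X : Type*} [TopologicalSpace X]

theorem toComplex_mul (c d : CompactlySupportedContinuousMap X ℝ) :
    toComplex (c * d) = toComplex c * toComplex d :=
  DFunLike.ext _ _ fun x => Complex.ofReal_mul (c x) (d x)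

theorem toComplex_add (c d : CompactlySupportedContinuousMap X ℝ) :
    toComplex (c + d) = toComplex c + toComplex d :=
  DFunLike.ext _ _ fun x => Complex.ofReal_add (c x) (d x)

theorem toComplex_smul (a : ℝ) (c : CompactlySupportedContinuousMap X ℝ) :
    toComplex (a • c) = (a : ℂ) • toComplex c :=
  DFunLike.ext _ _ fun x => Complex.ofReal_mul a (c x)

theorem contMDiff_toComplex (n : ℕ) [ChartedSpace (EuclideanSpace ℝ (Fin n)) X]
    {c : CompactlySupportedContinuousMap X ℝ}
    (hc : ContMDiff (𝓡 n) 𝓘(ℝ, ℝ) ∞ c) : ContMDiff (𝓡 n) 𝓘(ℝ, ℂ) ∞ (toComplex c) :=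
  Complex.ofRealCLM.contDiff.contMDiff.comp hc

/-- Every compactly supported function `f` equals `χ f` for some smooth compactly
supported `χ`. -/
theorem exists_smooth_mul_eq_self (n : ℕ) [ChartedSpace (EuclideanSpace ℝ (Fin n)) X]
    [IsManifold (𝓡 n) ∞ X] [T2Space X] [SigmaCompactSpace X]
    (f : CompactlySupportedContinuousMap X ℝ) :
    ∃ χ : CompactlySupportedContinuousMap X ℝ, ContMDiff (𝓡 n) 𝓘(ℝ, ℝ) ∞ χ ∧ χ * f = f := by
  have := Manifold.locallyCompact_of_finiteDimensional (𝓡 n) (M := X)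
  -- `χ` is a bump function equal to `1` near the support of `f` and to `0` outside the compact
  -- neighbourhood `K`.
  obtain ⟨K, hK, hfK⟩ := exists_compact_superset f.hasCompactSupport.isCompact
  obtain ⟨χ, h1, h0, -⟩ := exists_contMDiffMap_one_nhds_of_subset_interior (𝓡 n) (n := ⊤)
    (isClosed_tsupport f) hfK
  refine ⟨⟨⟨χ, χ.contMDiff.continuous⟩, HasCompactSupport.intro hK h0⟩, χ.contMDiff,
    DFunLike.ext _ _ fun x => ?_⟩
  change χ x * f x = f x
  by_cases hx : x ∈ tsupport f
  · rw [h1.self_of_nhdsSet x hx, one_mul]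
  · rw [image_eq_zero_of_notMem_tsupport hx, mul_zero]

end ToComplex

/-! ### Multiplication operators on `L²(X, E)` -/

section Multiplication

variable (n : ℕ) {X : Type*} [TopologicalSpace X] [ChartedSpace (EuclideanSpace ℝ (Fin n)) X]
  {F : Type*} [NormedAddCommGroup F] [NormedSpace ℂ F]
  {E : X → Type*} [TopologicalSpace (TotalSpace F E)] [∀ x, NormedAddCommGroup (E x)]
  [∀ x, InnerProductSpace ℂ (E x)] [FiberBundle F E] [VectorBundle ℂ F E]
  [RiemannianBundle (fun x : X => TangentSpace (𝓡 n) x)]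
  [IsSmoothHermitianBundle n F E] [IsManifold (𝓡 n) ∞ X]
  [IsContMDiffRiemannianBundle (𝓡 n) ∞ (EuclideanSpace ℝ (Fin n))
    (fun x : X => TangentSpace (𝓡 n) x)]
  [MeasurableSpace X] [BorelSpace X]

theorem mulOp_coe (φ : CompactlySupportedContinuousMap X ℂ) (f : CcSection n F E) :
    mulOp n φ (f : L2 n F E) = (CcSection.mulLinear φ f : CcSection n F E) :=
  ContinuousLinearMap.completion_apply_coe _ f

/-- Both sides are continuous in `u`, so it suffices to compare them on the dense subspace `C_c(X,
E)`, where the identity is pointwise. The other identities on `L²(X, E)` follow the same pattern. -/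
theorem mulOp_mul (φ ψ : CompactlySupportedContinuousMap X ℂ) (u : L2 n F E) :
    mulOp n (φ * ψ) u = mulOp n φ (mulOp n ψ u) := by
  induction u using UniformSpace.Completion.induction_on with
  | hp => exact isClosed_eq (by fun_prop) (by fun_prop)
  | ih f =>
    simp only [mulOp_coe]
    exact congrArg _ (CcSection.ext fun x => mul_smul (φ x) (ψ x) (f x))

theorem mulOp_add (φ ψ : CompactlySupportedContinuousMap X ℂ) (u : L2 n F E) :
    mulOp n (φ + ψ) u = mulOp n φ u + mulOp n ψ u := by
  induction u using UniformSpace.Completion.induction_on with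
  | hp => exact isClosed_eq (by fun_prop) (by fun_prop)
  | ih f =>
    simp only [mulOp_coe, ← UniformSpace.Completion.coe_add]
    exact congrArg _ (CcSection.ext fun x => add_smul (φ x) (ψ x) (f x))

theorem mulOp_smul (a : ℂ) (φ : CompactlySupportedContinuousMap X ℂ) (u : L2 n F E) :
    mulOp n (a • φ) u = a • mulOp n φ u := by
  induction u using UniformSpace.Completion.induction_on with
  | hp => exact isClosed_eq (mulOp n (a • φ)).continuous ((mulOp n φ).continuous.const_smul a)
  | ih f =>
    simp only [mulOp_coe, ← UniformSpace.Completion.coe_smul]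
    exact congrArg _ (CcSection.ext fun x => smul_assoc a (φ x) (f x))

theorem inner_mulOp_left (c : CompactlySupportedContinuousMap X ℝ) (u v : L2 n F E) :
    inner ℂ (mulOp n (toComplex c) u) v = inner ℂ u (mulOp n (toComplex c) v) := by
  induction u, v using UniformSpace.Completion.induction_on₂ with
  | hp => exact isClosed_eq (by fun_prop) (by fun_prop)
  | ih f h =>
    simp only [mulOp_coe, UniformSpace.Completion.inner_coe, CcSection.inner_def,
      CcSection.mulLinear_apply, inner_smul_left, inner_smul_right]
    refine integral_congr_ae (.of_forall fun x => ?_)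
    exact congrArg (· * _) (Complex.conj_ofReal (c x))

theorem isSelfAdjoint_mulOp (c : CompactlySupportedContinuousMap X ℝ) :
    IsSelfAdjoint (mulOp n (F := F) (E := E) (toComplex c)) :=
  ContinuousLinearMap.isSelfAdjoint_iff_isSymmetric.2 (inner_mulOp_left n c)

theorem re_inner_mulOp_nonneg {c : CompactlySupportedContinuousMap X ℝ} (hc : ∀ x, 0 ≤ c x)
    (u : L2 n F E) : 0 ≤ (inner ℂ u (mulOp n (toComplex c) u)).re := by
  induction u using UniformSpace.Completion.induction_on with
  | hp => exact isClosed_le (by fun_prop) (by fun_prop)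
  | ih f =>
    rw [mulOp_coe, UniformSpace.Completion.inner_coe, CcSection.inner_def]
    refine (integral_re (𝕜 := ℂ) (CcSection.integrable_inner _ _)).symm.trans_ge
      (integral_nonneg fun x => ?_)
    rw [CcSection.mulLinear_apply, inner_smul_right]
    change 0 ≤ ((c x : ℂ) * _).re
    rw [Complex.re_ofReal_mul]
    exact mul_nonneg (hc x) (inner_self_nonneg (𝕜 := ℂ))

end Multiplication

/-! ### The action of `G` on functions and sections -/

section TranslateCompact

variable (n : ℕ) {G : Type*} [Group G] {X : Type*} [TopologicalSpace X]
  [ChartedSpace (EuclideanSpace ℝ (Fin n)) X] [MulAction G X]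
  [RiemannianBundle (fun x : X => TangentSpace (𝓡 n) x)] [IsRiemannianAction n G X]
  {𝕜 : Type*} [TopologicalSpace 𝕜] [Zero 𝕜]

/-- The translate `x ↦ f (g⁻¹ x)` of a function. -/
def translateCompact (g : G)
    (f : CompactlySupportedContinuousMap X 𝕜) : CompactlySupportedContinuousMap X 𝕜 where
  toFun x := f (g⁻¹ • x)
  continuous_toFun := f.continuous.comp (smulHomeo n g⁻¹ : X ≃ₜ X).continuous
  hasCompactSupport' := f.hasCompactSupport.comp_homeomorph (smulHomeo n g⁻¹ : X ≃ₜ X)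

end TranslateCompact

theorem mk_section_congr {X F : Type*} {E : X → Type*} (f : ∀ x, E x) {x y : X} (h : x = y) :
    (⟨x, f x⟩ : TotalSpace F E) = ⟨y, f y⟩ := by
  subst h; rfl

section Translation

variable (n : ℕ) {G : Type*} [Group G] [TopologicalSpace G]
  {X : Type*} [TopologicalSpace X] [ChartedSpace (EuclideanSpace ℝ (Fin n)) X] [MulAction G X]
  {F : Type*} [NormedAddCommGroup F] [NormedSpace ℂ F]
  {E : X → Type*} [TopologicalSpace (TotalSpace F E)] [∀ x, NormedAddCommGroup (E x)]
  [∀ x, InnerProductSpace ℂ (E x)] [FiberBundle F E] [VectorBundle ℂ F E]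
  [hG : HermitianGBundle n G F E]

/-- In the total space the transport along `g • g⁻¹ • x = x` disappears, so the action laws of the
bundle can be applied by rewriting. -/
theorem mk_translateFun (g : G) (f : ∀ x, E x) (x : X) :
    (⟨x, translateFun n (F := F) g f x⟩ : TotalSpace F E) =
      ⟨g • g⁻¹ • x, hG.fiberMap g (g⁻¹ • x) (f (g⁻¹ • x))⟩ :=
  mk_cast (smul_inv_smul g x) _

theorem fiberMap_congr (g : G) {x y : X} {v : E x} {w : E y}
    (h : (⟨x, v⟩ : TotalSpace F E) = ⟨y, w⟩) :
    (⟨g • x, hG.fiberMap g x v⟩ : TotalSpace F E) = ⟨g • y, hG.fiberMap g y w⟩ := by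
  cases h; rfl

theorem translateFun_inv_translateFun (g : G) (f : ∀ x, E x) (x : X) :
    translateFun n (F := F) g⁻¹ (translateFun n (F := F) g f) x = f x := by
  have h : (⟨x, translateFun n (F := F) g⁻¹ (translateFun n (F := F) g f) x⟩ : TotalSpace F E) =
      ⟨x, f x⟩ := by
    rw [mk_translateFun, fiberMap_congr n g⁻¹ (mk_translateFun n g f _), ← hG.mul_smul',
      inv_mul_cancel, hG.one_smul']
    exact mk_section_congr f (by simp)
  -- Over one and the same base point, equality in the total space is equality in the fibre.
  exact eq_of_heq (TotalSpace.mk.inj h).2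

variable [RiemannianBundle (fun x : X => TangentSpace (𝓡 n) x)] [IsRiemannianAction n G X]
  [IsSmoothHermitianBundle n F E] [IsManifold (𝓡 n) ∞ X]
  [IsContMDiffRiemannianBundle (𝓡 n) ∞ (EuclideanSpace ℝ (Fin n))
    (fun x : X => TangentSpace (𝓡 n) x)]
  [MeasurableSpace X] [BorelSpace X]

theorem translateOp_coe (g : G) (f : CcSection n F E) :
    translateOp n F E g (f : L2 n F E) = (translateLinear n g f : CcSection n F E) :=
  ContinuousLinearMap.completion_apply_coe _ f

theorem translateOp_inv_apply (g : G) (u : L2 n F E) :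
    translateOp n F E g⁻¹ (translateOp n F E g u) = u := by
  induction u using UniformSpace.Completion.induction_on with
  | hp => exact isClosed_eq (by fun_prop) (by fun_prop)
  | ih f =>
    simp only [translateOp_coe]
    exact congrArg _ (CcSection.ext fun x => translateFun_inv_translateFun n g f x)

theorem norm_translateOp (g : G) (u : L2 n F E) : ‖translateOp n F E g u‖ = ‖u‖ := by
  induction u using UniformSpace.Completion.induction_on with
  | hp => exact isClosed_eq (by fun_prop) (by fun_prop)
  | ih f =>
    rw [translateOp_coe, UniformSpace.Completion.norm_coe, UniformSpace.Completion.norm_coe,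
      norm_translateLinear]

variable (F E) in
/-- The unitary operator of `L²(X, E)` given by `g`. -/
def translateEquiv (g : G) : L2 n F E ≃ₗᵢ[ℂ] L2 n F E where
  toFun := translateOp n F E g
  map_add' := map_add _
  map_smul' := map_smul _
  invFun := translateOp n F E g⁻¹
  left_inv := translateOp_inv_apply n g
  right_inv u := by simpa using translateOp_inv_apply n g⁻¹ u
  norm_map' := norm_translateOp n g

/-- Covariance of multiplication operators: the fibre maps are complex linear, so the scalar `φ (g⁻¹
x)` passes through them. -/
theorem translateOp_mulOp (g : G) (φ : CompactlySupportedContinuousMap X ℂ) (u : L2 n F E) :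
    translateOp n F E g (mulOp n φ u) = mulOp n (translateCompact n g φ) (translateOp n F E g u) := by
  induction u using UniformSpace.Completion.induction_on with
  | hp => exact isClosed_eq (by fun_prop) (by fun_prop)
  | ih f =>
    simp only [mulOp_coe, translateOp_coe]
    refine congrArg _ (CcSection.ext fun x => ?_)
    change translateFun n (F := F) g (fun y => φ y • f y) x = φ (g⁻¹ • x) • translateFun n (F := F) g f x
    simp only [translateFun, map_smul, cast_smul]

end Translation

/-! ### Invariant functionals on cutoff functions -/

section Averaging

variable {G : Type*} [Group G] [TopologicalSpace G] [IsTopologicalGroup G]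
  {X : Type*} [TopologicalSpace X] [MulAction G X] [ProperSMul G X]

/-- Properness: the preimage of `supp c × {x}` under `(g, y) ↦ (g y, y)` is compact, and its
projection to `G` contains the support. -/
theorem hasCompactSupport_orbit {c : X → ℝ} (hc : HasCompactSupport c) (x : X) :
    HasCompactSupport fun g : G => c (g • x) := by
  refine HasCompactSupport.of_support_subset_isCompact
    (((ProperSMul.isProperMap_smul_pair (G := G) (X := X)).isCompact_preimage
      (hc.isCompact.prod (isCompact_singleton (x := x)))).image continuous_fst) fun g hg => ?_
  exact ⟨(g, x), ⟨subset_tsupport c hg, rfl⟩, rfl⟩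

variable [T2Space X]

/-- Compactness of the support on `G × X` allows Fubini for continuous integrands without
σ-finiteness assumptions on the measures. -/
theorem hasCompactSupport_mul_smul {c d : X → ℝ} (hc : HasCompactSupport c)
    (hd : HasCompactSupport d) :
    HasCompactSupport fun p : G × X => c (p.1 • p.2) * d p.2 := by
  refine HasCompactSupport.of_support_subset_isCompact
    ((ProperSMul.isProperMap_smul_pair (G := G) (X := X)).isCompact_preimage
      (hc.isCompact.prod hd.isCompact)) fun p hp => ?_
  exact ⟨subset_tsupport c (left_ne_zero_of_mul hp), subset_tsupport d (right_ne_zero_of_mul hp)⟩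

variable [MeasurableSpace G] [BorelSpace G]
  (μ : Measure G) [μ.IsHaarMeasure] [μ.IsMulRightInvariant]
  (n : ℕ) [LocallyCompactSpace X] [MeasurableSpace X] [BorelSpace X]
  [ChartedSpace (EuclideanSpace ℝ (Fin n)) X]
  [RiemannianBundle (fun x : X => TangentSpace (𝓡 n) x)] [IsRiemannianAction n G X]

/-- A `G`-invariant positive functional takes the same value on all cutoff functions. -/
theorem eq_of_integral_translate_eq_one
    (Λ : CompactlySupportedContinuousMap X ℝ →ₚ[ℝ] ℝ)
    (hΛ : ∀ (g : G) (f : CompactlySupportedContinuousMap X ℝ), Λ (translateCompact n g f) = Λ f)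
    {c d : CompactlySupportedContinuousMap X ℝ} (hc : ∀ x, ∫ g : G, c (g⁻¹ • x) ∂μ = 1)
    (hd : ∀ x, ∫ g : G, d (g⁻¹ • x) ∂μ = 1) : Λ c = Λ d := by
  set m := RealRMK.rieszMeasure Λ
  have hm : ∀ f : CompactlySupportedContinuousMap X ℝ, ∫ x, f x ∂m = Λ f :=
    RealRMK.integral_rieszMeasure Λ
  have hcomp := hasCompactSupport_mul_smul (G := G) d.hasCompactSupport c.hasCompactSupport
  have hcomp' := hasCompactSupport_mul_smul (G := G) c.hasCompactSupport d.hasCompactSupport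
  -- Unimodularity enters here: the normalisation over `g⁻¹ x` passes to `g x`.
  have hc' : ∀ x, ∫ g : G, c (g • x) ∂μ = 1 := fun x => by
    rw [← hc x]
    exact (integral_inv_eq_self_of_hasCompactSupport μ
      (c.continuous.comp (continuous_id.smul continuous_const))
      (hasCompactSupport_orbit c.hasCompactSupport x)).symm
  have hg : ∀ g : G, ∫ x, d (g⁻¹ • x) * c x ∂m = ∫ x, c (g • x) * d x ∂m := fun g => by
    -- Translating `x ↦ d(g⁻¹x) c(x)` by `g⁻¹` substitutes `g x` for `x`.
    have h := hΛ g⁻¹ (translateCompact n g d * c)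
    rw [← hm, ← hm] at h
    refine h.symm.trans (integral_congr_ae (.of_forall fun x => ?_))
    change d (g⁻¹ • g⁻¹⁻¹ • x) * c (g⁻¹⁻¹ • x) = _
    rw [inv_inv, inv_smul_smul, mul_comm]
  calc Λ c = ∫ x, c x ∂m := (hm c).symm
    -- The factor `1 = ∫ d(g⁻¹x) dg` is inserted; at the end the integral of `c(gx)` is removed
    -- likewise.
    _ = ∫ x, ∫ g : G, d (g⁻¹ • x) * c x ∂μ ∂m := by
        simp only [integral_mul_const, hd, one_mul]
    _ = ∫ g : G, ∫ x, d (g⁻¹ • x) * c x ∂m ∂μ := by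
        refine (integral_integral_swap_of_hasCompactSupport
          (f := fun (g : G) (x : X) => d (g⁻¹ • x) * c x) ?_ ?_).symm
        · exact (d.continuous.comp (continuous_fst.inv.smul continuous_snd)).mul
            (c.continuous.comp continuous_snd)
        · exact hcomp.comp_homeomorph ((Homeomorph.inv G).prodCongr (Homeomorph.refl X))
    _ = ∫ g : G, ∫ x, c (g • x) * d x ∂m ∂μ := by simp only [hg]
    _ = ∫ x, ∫ g : G, c (g • x) * d x ∂μ ∂m :=
        integral_integral_swap_of_hasCompactSupport
          (f := fun (g : G) (x : X) => c (g • x) * d x)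
          ((c.continuous.comp (continuous_fst.smul continuous_snd)).mul
            (d.continuous.comp continuous_snd)) hcomp'
    _ = ∫ x, d x ∂m := by simp only [integral_mul_const, hc', one_mul]
    _ = Λ d := hm d

end Averaging

/-! ### The local trace as a positive invariant functional -/

section LocalTrace

variable (n : ℕ) {X : Type*} [TopologicalSpace X] [ChartedSpace (EuclideanSpace ℝ (Fin n)) X]
  {F : Type*} [NormedAddCommGroup F] [NormedSpace ℂ F]
  {E : X → Type*} [TopologicalSpace (TotalSpace F E)] [∀ x, NormedAddCommGroup (E x)]
  [∀ x, InnerProductSpace ℂ (E x)] [FiberBundle F E] [VectorBundle ℂ F E]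
  [RiemannianBundle (fun x : X => TangentSpace (𝓡 n) x)]
  [IsSmoothHermitianBundle n F E] [IsManifold (𝓡 n) ∞ X]
  [IsContMDiffRiemannianBundle (𝓡 n) ∞ (EuclideanSpace ℝ (Fin n))
    (fun x : X => TangentSpace (𝓡 n) x)]
  [MeasurableSpace X] [BorelSpace X]

/-- The operator `A` on `L²(X, E)` is locally Hilbert–Schmidt: for every `f ∈ C_c(X)`, the operator
`f A` is Hilbert–Schmidt. -/
def IsLocallyHilbertSchmidt (A : L2 n F E →L[ℂ] L2 n F E) : Prop :=
  ∀ (f : CompactlySupportedContinuousMap X ℝ) (s : Set (L2 n F E)) (b : HilbertBasis s ℂ (L2 n F E)),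
    Summable fun i => ‖mulOp n (toComplex f) (A (b i))‖ ^ 2

/-- The sum `∑ ⟪A bᵢ, f A bᵢ⟫`, which for self-adjoint `A` stands for the trace of `f A²`. -/
def localTrace (A : L2 n F E →L[ℂ] L2 n F E) {s : Set (L2 n F E)}
    (b : HilbertBasis s ℂ (L2 n F E)) (f : CompactlySupportedContinuousMap X ℝ) : ℂ :=
  ∑' i, inner ℂ (A (b i)) (mulOp n (toComplex f) (A (b i)))

variable {n} {A : L2 n F E →L[ℂ] L2 n F E} {s : Set (L2 n F E)}

/-- `c₁ A² c₂` is the product of the Hilbert–Schmidt operators `c₁ A` and `A c₂`. Moving the factors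
cyclically brings `c₂` next to `c₁`, and multiplications commute. The basis `e` of the trace and the
basis `b` of the local trace are unrelated. -/
theorem hasSum_sandwich_localTrace (hA : IsSelfAdjoint A) (hHS : IsLocallyHilbertSchmidt n A)
    {s' : Set (L2 n F E)} (e : HilbertBasis s' ℂ (L2 n F E)) (b : HilbertBasis s ℂ (L2 n F E))
    (c₁ c₂ : CompactlySupportedContinuousMap X ℝ) :
    HasSum (fun i => inner ℂ (e i) (sandwich n c₁ (A ∘L A) c₂ (e i)))
      (localTrace n A b (c₁ * c₂)) := by
  have h := hasSum_inner_comp hA (isSelfAdjoint_mulOp n c₁) (isSelfAdjoint_mulOp n c₂) e b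
    (hHS c₁ s b) (hHS c₂ s b)
  simp only [← mulOp_mul, ← toComplex_mul] at h
  rw [localTrace, mul_comm c₁ c₂]
  exact h

variable [T2Space X] [SigmaCompactSpace X]

/-- Trace class of `χ A² χ` makes `A χ` Hilbert–Schmidt, hence also its adjoint `χ A`, now in every
basis. Then `f A = f (χ A)` when `χ f = f`. This passes from smooth functions to all of `C_c(X)`,
the domain of the Riesz theorem. -/
theorem isLocallyHilbertSchmidt_of_isTraceClass (hA : IsSelfAdjoint A)
    (h : ∀ χ : CompactlySupportedContinuousMap X ℝ, ContMDiff (𝓡 n) 𝓘(ℝ, ℝ) ∞ χ →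
      IsTraceClass (sandwich n χ (A ∘L A) χ)) : IsLocallyHilbertSchmidt n A := by
  intro f s e
  obtain ⟨χ, hχ, hχf⟩ := exists_smooth_mul_eq_self n f
  obtain ⟨t, b, hb⟩ := exists_summable_norm_sq_of_isTraceClass hA (isSelfAdjoint_mulOp n χ) (h χ hχ)
  have h1 := summable_norm_adjoint_sq (K := A ∘L mulOp n (toComplex χ)) b e hb
  rw [ContinuousLinearMap.adjoint_comp, hA.adjoint_eq, (isSelfAdjoint_mulOp n χ).adjoint_eq] at h1
  refine (summable_norm_clm_sq h1 (mulOp n (toComplex f))).congr fun i => ?_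
  rw [ContinuousLinearMap.comp_apply, ← mulOp_mul, ← toComplex_mul, mul_comm f χ, hχf]

/-- With `f = χ f` the terms become `⟪χ A bᵢ, f A bᵢ⟫`, inner products of two square-summable
families. -/
theorem summable_localTrace (hHS : IsLocallyHilbertSchmidt n A) (b : HilbertBasis s ℂ (L2 n F E))
    (f : CompactlySupportedContinuousMap X ℝ) :
    Summable fun i => inner ℂ (A (b i)) (mulOp n (toComplex f) (A (b i))) := by
  obtain ⟨χ, -, hχf⟩ := exists_smooth_mul_eq_self n f
  refine (summable_inner_of_summable_norm_sq (hHS χ s b) (hHS f s b)).congr fun i => ?_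
  rw [inner_mulOp_left, ← mulOp_mul, ← toComplex_mul, hχf]

/-- With `f = χ f`, both values are the sum of one and the same series, the trace of `χ A² f` in the
basis `b`. -/
theorem localTrace_eq_localTrace (hA : IsSelfAdjoint A) (hHS : IsLocallyHilbertSchmidt n A)
    {s' : Set (L2 n F E)} (e : HilbertBasis s' ℂ (L2 n F E)) (b : HilbertBasis s ℂ (L2 n F E))
    (f : CompactlySupportedContinuousMap X ℝ) : localTrace n A e f = localTrace n A b f := by
  obtain ⟨χ, -, hχf⟩ := exists_smooth_mul_eq_self n f
  rw [← hχf]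
  exact (hasSum_sandwich_localTrace hA hHS b e χ f).unique
    (hasSum_sandwich_localTrace hA hHS b b χ f)

/-- The positive functional `f ↦ Re ∑ ⟪A bᵢ, f A bᵢ⟫` on `C_c(X)`. -/
def localTraceFunctional (hHS : IsLocallyHilbertSchmidt n A) (b : HilbertBasis s ℂ (L2 n F E)) :
    CompactlySupportedContinuousMap X ℝ →ₚ[ℝ] ℝ :=
  PositiveLinearMap.mk₀
    { toFun := fun f => (localTrace n A b f).re
      map_add' := fun f h => by
        rw [← Complex.add_re, localTrace, localTrace, localTrace,
          ← (summable_localTrace hHS b f).tsum_add (summable_localTrace hHS b h)]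
        simp only [toComplex_add, mulOp_add, inner_add_right]
      map_smul' := fun a f => by
        rw [RingHom.id_apply, smul_eq_mul, ← Complex.re_ofReal_mul, localTrace, localTrace,
          ← tsum_mul_left]
        simp only [toComplex_smul, mulOp_smul, inner_smul_right] }
    fun f hf => by
      change 0 ≤ (localTrace n A b f).re
      rw [localTrace, Complex.re_tsum (summable_localTrace hHS b f)]
      exact tsum_nonneg fun i => re_inner_mulOp_nonneg n hf _

/-- Nothing is lost by taking the real part: multiplication by a real `f` is symmetric, so every
term is real. -/
theorem ofReal_localTraceFunctional (hHS : IsLocallyHilbertSchmidt n A)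
    (b : HilbertBasis s ℂ (L2 n F E)) (f : CompactlySupportedContinuousMap X ℝ) :
    (localTraceFunctional hHS b f : ℂ) = localTrace n A b f := by
  change ((localTrace n A b f).re : ℂ) = _
  refine Complex.conj_eq_iff_re.1 ?_
  rw [localTrace, Complex.conj_tsum]
  exact tsum_congr fun i => by rw [inner_conj_symm, inner_mulOp_left]

variable {G : Type*} [Group G] [TopologicalSpace G] [MulAction G X] [IsRiemannianAction n G X]
  [HermitianGBundle n G F E]

/-- For a `G`-invariant operator, the local trace is `G`-invariant. -/
theorem localTrace_translateCompact (hA : IsSelfAdjoint A) (hHS : IsLocallyHilbertSchmidt n A)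
    (hG : IsGInvariant n G A) (b : HilbertBasis s ℂ (L2 n F E)) (g : G)
    (f : CompactlySupportedContinuousMap X ℝ) :
    localTrace n A b (translateCompact n g f) = localTrace n A b f := by
  -- The basis `b` translated by the unitary operator of `g`. In it the local trace of the translate
  -- of `f` agrees term by term with that of `f` in `b`.
  let e : HilbertBasis s ℂ (L2 n F E) :=
    HilbertBasis.ofRepr ((translateEquiv n F E g).symm.trans b.repr)
  have he : ∀ i, e i = translateOp n F E g (b i) := fun i => rfl
  have hAU : ∀ u, A (translateOp n F E g u) = translateOp n F E g (A u) := fun u =>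
    (congrArg (fun T => T u) (hG g)).symm
  rw [localTrace_eq_localTrace hA hHS b e]
  refine tsum_congr fun i => ?_
  rw [he, hAU, show toComplex (translateCompact n g f) = translateCompact n g (toComplex f) from rfl,
    ← translateOp_mulOp]
  exact (translateEquiv n F E g).inner_map_map _ _

end LocalTrace

end GTrace

end

/-! ### Independence of the cutoff pair -/

theorem mainTheorem12
    -- the locally compact unimodular group `G` with its bi-invariant Haar measure `μ`
    {G : Type*} [Group G] [TopologicalSpace G] [IsTopologicalGroup G] [LocallyCompactSpace G]
    [T2Space G] [MeasurableSpace G] [BorelSpace G]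
    (μ : Measure G) [μ.IsHaarMeasure] [μ.IsMulRightInvariant]
    -- the complete Riemannian manifold `X` of dimension `n`
    (n : ℕ) {X : Type*} [EMetricSpace X] [SecondCountableTopology X]
    [ChartedSpace (EuclideanSpace ℝ (Fin n)) X] [IsManifold (𝓡 n) ∞ X]
    [RiemannianBundle (fun x : X => TangentSpace (𝓡 n) x)]
    [IsContMDiffRiemannianBundle (𝓡 n) ∞ (EuclideanSpace ℝ (Fin n))
      (fun x : X => TangentSpace (𝓡 n) x)]
    [IsRiemannianManifold (𝓡 n) X] [CompleteSpace X] [MeasurableSpace X] [BorelSpace X]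
    -- the proper, cocompact, isometric action
    [MulAction G X] [ProperSMul G X] [CompactSpace (MulAction.orbitRel.Quotient G X)]
    [GTrace.IsRiemannianAction n G X]
    -- the smooth complex Hermitian `G`-vector bundle `E` with model fibre `F`
    {F : Type*} [NormedAddCommGroup F] [NormedSpace ℂ F] [FiniteDimensional ℂ F]
    {E : X → Type*} [TopologicalSpace (TotalSpace F E)] [∀ x, NormedAddCommGroup (E x)]
    [∀ x, InnerProductSpace ℂ (E x)] [FiberBundle F E] [VectorBundle ℂ F E]
    [ContMDiffVectorBundle ∞ F E (𝓡 n)] [GTrace.IsSmoothHermitianBundle n F E]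
    [GTrace.HermitianGBundle n G F E]
    -- the positive operator `S` of `G`-trace class
    (S : GTrace.L2 n F E →L[ℂ] GTrace.L2 n F E) (hpos : S.IsPositive)
    (hS : GTrace.IsGTraceClass n G S) :
    (∀ c₁ c₂ d₁ d₂ : CompactlySupportedContinuousMap X ℝ,
      GTrace.IsCutoffPair n μ c₁ c₂ → GTrace.IsCutoffPair n μ d₁ d₂ →
        GTrace.trace (GTrace.sandwich n c₁ S c₂) = GTrace.trace (GTrace.sandwich n d₁ S d₂)) ∧
    (∀ c₁ c₂ : CompactlySupportedContinuousMap X ℝ, GTrace.IsCutoffPair n μ c₁ c₂ →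
      GTrace.IsTraceClass (GTrace.sandwich n c₁ S c₂) ∧
      GTrace.HasTrace (GTrace.sandwich n c₁ S c₂) (GTrace.gTrace n μ S)) := by
  have hS0 : 0 ≤ S := (ContinuousLinearMap.nonneg_iff_isPositive S).2 hpos
  have habs : GTrace.operatorAbs S = S := GTrace.operatorAbs_of_isPositive hpos
  have : LocallyCompactSpace X := Manifold.locallyCompact_of_finiteDimensional (𝓡 n)
  have htc : ∀ c₁ c₂ : CompactlySupportedContinuousMap X ℝ, ContMDiff (𝓡 n) 𝓘(ℝ, ℝ) ∞ c₁ →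
      ContMDiff (𝓡 n) 𝓘(ℝ, ℝ) ∞ c₂ → GTrace.IsTraceClass (GTrace.sandwich n c₁ S c₂) := by
    intro c₁ c₂ h₁ h₂
    have h := hS.isTraceClass _ _ (GTrace.contMDiff_toComplex n h₁) (GTrace.contMDiff_toComplex n h₂)
    rwa [habs] at h
  set A := CFC.sqrt S
  have hA : IsSelfAdjoint A := (CFC.sqrt_nonneg S).isSelfAdjoint
  have hAA : A ∘L A = S := CFC.sqrt_mul_sqrt_self S hS0
  -- The square root comes from the functional calculus of `S`, so it commutes with whatever
  -- commutes with `S`.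
  have hAG : GTrace.IsGInvariant n G A := fun g =>
    (Commute.cfcₙ_nnreal (hS.invariant g).symm NNReal.sqrt).eq.symm
  have hHS : GTrace.IsLocallyHilbertSchmidt n A :=
    GTrace.isLocallyHilbertSchmidt_of_isTraceClass hA fun χ hχ => by
      rw [hAA]
      exact htc χ χ hχ hχ
  set b := GTrace.someHilbertBasis (GTrace.L2 n F E)
  have htrace : ∀ c₁ c₂ : CompactlySupportedContinuousMap X ℝ,
      GTrace.HasTrace (GTrace.sandwich n c₁ S c₂) (GTrace.localTrace n A b (c₁ * c₂)) := by
    intro c₁ c₂ s e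
    rw [← hAA]
    exact GTrace.hasSum_sandwich_localTrace hA hHS e b c₁ c₂
  have heq : ∀ c₁ c₂ : CompactlySupportedContinuousMap X ℝ,
      GTrace.trace (GTrace.sandwich n c₁ S c₂) = GTrace.localTrace n A b (c₁ * c₂) :=
    fun c₁ c₂ => (htrace c₁ c₂ _ _).tsum_eq
  have hcut : ∀ c₁ c₂ d₁ d₂ : CompactlySupportedContinuousMap X ℝ,
      GTrace.IsCutoffPair n μ c₁ c₂ → GTrace.IsCutoffPair n μ d₁ d₂ →
        GTrace.localTrace n A b (c₁ * c₂) = GTrace.localTrace n A b (d₁ * d₂) := by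
    intro c₁ c₂ d₁ d₂ hc hd
    -- Both products are cutoff functions, on which the positive invariant functional takes a single
    -- value.
    rw [← GTrace.ofReal_localTraceFunctional hHS, ← GTrace.ofReal_localTraceFunctional hHS,
      GTrace.eq_of_integral_translate_eq_one μ n (GTrace.localTraceFunctional hHS b)
        (fun g f => congrArg Complex.re (GTrace.localTrace_translateCompact hA hHS hAG b g f))
        hc.isCutoff.integral_eq_one hd.isCutoff.integral_eq_one]
  refine ⟨fun c₁ c₂ d₁ d₂ hc hd => ?_, fun c₁ c₂ hc => ⟨htc c₁ c₂ hc.smooth₁ hc.smooth₂, ?_⟩⟩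
  · rw [heq, heq, hcut c₁ c₂ d₁ d₂ hc hd]
  · have hex : ∃ p : CompactlySupportedContinuousMap X ℝ × CompactlySupportedContinuousMap X ℝ,
        GTrace.IsCutoffPair n μ p.1 p.2 := ⟨(c₁, c₂), hc⟩
    -- The pair chosen in the definition of the `G`-trace may differ from `c₁`, `c₂`; `hcut`
    -- identifies the two values.
    rw [GTrace.gTrace, dif_pos hex, heq, hcut _ _ c₁ c₂ hex.choose_spec hc]
    exact htrace c₁ c₂
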